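/- Pure states are unit vectors, considered up to a global phase. A set $\mathcal S$ of pure states in a Hilbert space is an *$m$-dimensional hyperdisk* if there are an orthonormal basis $(\phi_j)_{j<m}$ of $\mathrm{span}\,\mathcal S$ and strictly positive numbers $r_0,\dots,r_{m-1}$ such that $\mathcal S$ is exactly the set of pure states $\psi$ with $|\langle\phi_j|\psi\rangle|=r_j$ for all $j$; a hyperdisk contained in $\mathcal S$ is a *subhyperdisk* of $\mathcal S$. A three-dimensional *Schmidt hyperdisk* in $\mathcal H_A\otimes\mathcal H_B$ is a set $\{\sum_{j=0}^{2} r_je^{i\theta_j}|\phi^A_j\phi^B_j\rangle : \theta\in\mathbb R^3\}$ with orthonormal $(\phi^A_j)_j$ in $\mathcal H_A$ and $(\phi^B_j)_j$ in $\mathcal H_B$, $r_j\in\mathbb R\setminus\{0\}$ and $\sum_j r_j^2=1$. Let $\mathcal H_A,\mathcal H_B$ be finite-dimensional complex Hilbert spaces and let $\mathcal H_R$ be a Hilbert space of dimension $n=3$. Let $V:\mathcal H_R\to\mathcal H_A\otimes\mathcal H_B$ be a masking machine for a set $\mathcal R$ of pure states of $\mathcal H_R$, that is, a linear isometry such that for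 some $\rho_A,\rho_B$ the set $\mathcal R$ consists of exactly those pure states $\psi\in\mathcal H_R$ for which $\Psi=V\psi$ satisfies $\mathrm{Tr}_B|\Psi\rangle\langle\Psi|=\rho_A$ and $\mathrm{Tr}_A|\Psi\rangle\langle\Psi|=\rho_B$. Assume that $\mathcal R$ spans $\mathcal H_R$ and that $\rho_A$ and $\rho_B$ have rank $d=3$. Let $\mathcal T=V\mathcal R$ be the set of target states. If $\mathcal T$ contains a two-dimensional subhyperdisk of a three-dimensional Schmidt hyperdisk, then $\mathcal T$ is of one of the following three types. In each explicit form $\{|0\rangle,|1\rangle,|2\rangle\}$ stands for some orthonormal triple in $\mathcal H_A$ and also for some orthonormal triple in $\mathcal H_B$, and sets are given up to global phases. * **Type I.** $\mathcal T$ is a three-dimensional Schmidt hyperdisk: $$\mathcal T=\{\sqrt{\lambda_0}|00\rangle+e^{i\theta_1}\sqrt{\lambda_1}|11\rangle+e^{i\theta_2}\sqrt{\lambda_2}|22\rangle:\theta_1,\theta_2\in\mathbb R\},\qquad \lambda_j>0,\ \textstyle\sum_j\lambda_j=1.$$ * **Type II.** $\mathcal T=\mathcal S_0\cup\mathcal S_1$,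 where $\mathcal S_0$ and $\mathcal S_1$ are two-dimensional subhyperdisks of three-dimensional Schmidt hyperdisks, and no Schmidt hyperdisk contains both of them; explicitly, for some $\lambda_1,\lambda_2>0$ with $2\lambda_1+\lambda_2=1$, $$\mathcal S_0=\{\sqrt{\lambda_1}|00\rangle+e^{i\alpha}(\sqrt{\lambda_1}|11\rangle+\sqrt{\lambda_2}|22\rangle):\alpha\in\mathbb R\},$$ $$\mathcal S_1=\{\sqrt{\lambda_1}(|\phi^-\psi^-\rangle+e^{i\beta}|\phi^+\psi^+\rangle)+\sqrt{\lambda_2}|22\rangle:\beta\in\mathbb R\},$$ where $\{\phi^+,\phi^-\}$ and $\{\psi^+,\psi^-\}$ are orthonormal bases of $\mathrm{span}\{|0\rangle,|1\rangle\}$ in $\mathcal H_A$ and in $\mathcal H_B$, and $0<|\langle0|\phi^+\rangle|=|\langle0|\psi^+\rangle|<1$. * **Type III.** $\mathcal T=\mathcal S_0\cup\{\Psi'\}$, where $\mathcal S_0$ is a two-dimensional subhyperdisk of a three-dimensional Schmidt hyperdisk and $\Psi'$ is a single state that lies on a three-dimensional Schmidt hyperdisk, but on none that contains $\mathcal S_0$;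 explicitly, $$\mathcal S_0=\{\tfrac1{\sqrt3}(|00\rangle+e^{i\alpha}(|11\rangle+|22\rangle)):\alpha\in\mathbb R\},$$ $$\Psi'=\tfrac1{\sqrt3}\Big[\cos\tfrac\theta2|00\rangle+\sin\tfrac\theta2\big(e^{i\varphi_0}|10\rangle+e^{i\varphi_1}|0\rangle|\psi^+\rangle\big)+e^{i(\varphi_0+\varphi_1)}\big(e^{i\eta}|2\rangle|\psi^-\rangle-\cos\tfrac\theta2|1\rangle|\psi^+\rangle\big)\Big],$$ where $\theta\in(0,\pi]$, $\varphi_0,\varphi_1,\eta\in\mathbb R$, $\{\psi^+,\psi^-\}$ is an orthonormal basis of $\mathrm{span}\{|1\rangle,|2\rangle\}$ in $\mathcal H_B$, and $|\langle1|\psi^+\rangle|\neq1$. -/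

import Mathlib

noncomputable section

namespace Masking

open Complex

/-! Pure states are unit vectors; the same physical state is represented by all its multiples by a
phase, so that "a single state" `ψ` is the set `rays {ψ}`. -/

/-- All representatives (up to a global phase) of the states in `X`. -/
def rays {E : Type*} [NormedAddCommGroup E] [InnerProductSpace ℂ E] (X : Set E) : Set E :=
  {y | ∃ z : ℂ, ‖z‖ = 1 ∧ ∃ x ∈ X, y = z • x}

/-- The vector of the moduli `|⟨φ_j|ψ⟩|` for a family `B = (φ_j)`. -/
def coeffVector {E : Type*} [NormedAddCommGroup E] [InnerProductSpace ℂ E] {m : ℕ}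
    (B : Fin m → E) (ψ : E) : Fin m → ℝ :=
  fun j => ‖inner ℂ (B j) ψ‖

/-- `S` is an `m`-dimensional hyperdisk: a set of pure states such that, for some orthonormal basis
`B` of `span S` and some vector `r` with strictly positive entries, `S` consists of exactly
the pure states whose coefficient vector with respect to `B` is `r`. -/
def IsHyperdisk {E : Type*} [NormedAddCommGroup E] [InnerProductSpace ℂ E] (m : ℕ)
    (S : Set E) : Prop :=
  (∀ ψ ∈ S, ‖ψ‖ = 1) ∧
  ∃ (B : Fin m → E) (r : Fin m → ℝ),
    Orthonormal ℂ B ∧ Submodule.span ℂ (Set.range B) = Submodule.span ℂ S ∧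
    (∀ j, 0 < r j) ∧
    (∀ ψ ∈ S, coeffVector B ψ = r) ∧
    (∀ ξ : E, ‖ξ‖ = 1 → ξ ∉ S → coeffVector B ξ ≠ r)

/-- `S'` is an `m`-dimensional subhyperdisk of `S`. -/
def IsSubhyperdisk {E : Type*} [NormedAddCommGroup E] [InnerProductSpace ℂ E] (m : ℕ)
    (S' S : Set E) : Prop :=
  S' ⊆ S ∧ IsHyperdisk m S'

section Bipartite

variable {ιA ιB : Type*} [Fintype ιA] [Fintype ιB]

/-- The product vector `|a⟩|b⟩` in `ℂ^ιA ⊗ ℂ^ιB = ℂ^(ιA × ιB)`. -/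
def prodKet (a : EuclideanSpace ℂ ιA) (b : EuclideanSpace ℂ ιB) :
    EuclideanSpace ℂ (ιA × ιB) :=
  WithLp.toLp 2 fun p => a p.1 * b p.2

/-- The operator `|Ψ⟩⟨Ψ|`. -/
def ketBra (Ψ : EuclideanSpace ℂ (ιA × ιB)) : Matrix (ιA × ιB) (ιA × ιB) ℂ :=
  Matrix.of fun p q => Ψ p * star (Ψ q)

/-- Partial trace over the second factor. -/
def traceB (M : Matrix (ιA × ιB) (ιA × ιB) ℂ) : Matrix ιA ιA ℂ :=
  Matrix.of fun i i' => ∑ j, M (i, j) (i', j)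

/-- Partial trace over the first factor. -/
def traceA (M : Matrix (ιA × ιB) (ιA × ιB) ℂ) : Matrix ιB ιB ℂ :=
  Matrix.of fun j j' => ∑ i, M (i, j) (i, j')

/-- `S` is a Schmidt hyperdisk with `d` terms: the set of all states
`∑ j, r_j e^{iθ_j} |φ_j^A φ_j^B⟩`, `θ ∈ ℝ^d`, with fixed nonzero `r_j` and fixed orthonormal
families `φ^A`, `φ^B` of length `d` (bases, if the local dimension is `d`). -/
def IsSchmidtHyperdisk (d : ℕ) (S : Set (EuclideanSpace ℂ (ιA × ιB))) : Prop :=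
  ∃ (a : Fin d → EuclideanSpace ℂ ιA) (b : Fin d → EuclideanSpace ℂ ιB) (r : Fin d → ℝ),
    Orthonormal ℂ a ∧ Orthonormal ℂ b ∧ (∀ j, r j ≠ 0) ∧ ∑ j, r j ^ 2 = 1 ∧
    S = {Ψ | ∃ θ : Fin d → ℝ, Ψ = ∑ j, ((r j : ℂ) * exp (θ j * I)) • prodKet (a j) (b j)}

/-- The linear isometry `V` is a masking machine for the set of pure states `R`, with marginal
states `ρA`, `ρB`. -/
def IsMaskingMachine {HR : Type*} [NormedAddCommGroup HR] [InnerProductSpace ℂ HR]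
    (V : HR →ₗᵢ[ℂ] EuclideanSpace ℂ (ιA × ιB)) (R : Set HR)
    (ρA : Matrix ιA ιA ℂ) (ρB : Matrix ιB ιB ℂ) : Prop :=
  (∀ ψ ∈ R, ‖ψ‖ = 1) ∧
  (∀ ψ ∈ R, traceB (ketBra (V ψ)) = ρA ∧ traceA (ketBra (V ψ)) = ρB) ∧
  (∀ ψ : HR, ‖ψ‖ = 1 → ψ ∉ R →
    traceB (ketBra (V ψ)) ≠ ρA ∨ traceA (ketBra (V ψ)) ≠ ρB)

/-- `X` and `Y` do not lie on a common Schmidt hyperdisk. -/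
def OnDifferentSchmidtHyperdisks (X Y : Set (EuclideanSpace ℂ (ιA × ιB))) : Prop :=
  ∀ S : Set (EuclideanSpace ℂ (ιA × ιB)), IsSchmidtHyperdisk 3 S → ¬ (X ∪ Y ⊆ S)

/-- `T` is, up to global phases, the family
`√λ₀|00⟩ + e^{iθ₁}√λ₁|11⟩ + e^{iθ₂}√λ₂|22⟩`, `θ₁, θ₂ ∈ ℝ`. -/
def FormI (T : Set (EuclideanSpace ℂ (ιA × ιB))) : Prop :=
  ∃ (a : Fin 3 → EuclideanSpace ℂ ιA) (b : Fin 3 → EuclideanSpace ℂ ιB) (l : Fin 3 → ℝ),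
    Orthonormal ℂ a ∧ Orthonormal ℂ b ∧ (∀ j, 0 < l j) ∧ ∑ j, l j = 1 ∧
    T = rays {Ψ | ∃ θ₁ θ₂ : ℝ,
      Ψ = (√(l 0) : ℂ) • prodKet (a 0) (b 0)
        + (exp (θ₁ * I) * (√(l 1) : ℂ)) • prodKet (a 1) (b 1)
        + (exp (θ₂ * I) * (√(l 2) : ℂ)) • prodKet (a 2) (b 2)}

/-- Up to global phases, `S₀` is the family `√λ₁|00⟩ + e^{iα}(√λ₁|11⟩ + √λ₂|22⟩)` and `S₁` is the
family `√λ₁(|φ⁻ψ⁻⟩ + e^{iβ}|φ⁺ψ⁺⟩) + √λ₂|22⟩`, where `φ^±` and `ψ^±` are orthonormal bases of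
`span{|0⟩,|1⟩}` (in the first and second factor) with `0 < |⟨0|φ⁺⟩| = |⟨0|ψ⁺⟩| < 1`. -/
def FormII (S₀ S₁ : Set (EuclideanSpace ℂ (ιA × ιB))) : Prop :=
  ∃ (a : Fin 3 → EuclideanSpace ℂ ιA) (b : Fin 3 → EuclideanSpace ℂ ιB) (l₁ l₂ : ℝ)
    (φp φm : EuclideanSpace ℂ ιA) (ψp ψm : EuclideanSpace ℂ ιB),
    Orthonormal ℂ a ∧ Orthonormal ℂ b ∧ 0 < l₁ ∧ 0 < l₂ ∧ 2 * l₁ + l₂ = 1 ∧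
    Orthonormal ℂ ![φp, φm] ∧ Submodule.span ℂ {φp, φm} = Submodule.span ℂ {a 0, a 1} ∧
    Orthonormal ℂ ![ψp, ψm] ∧ Submodule.span ℂ {ψp, ψm} = Submodule.span ℂ {b 0, b 1} ∧
    0 < ‖inner ℂ (a 0) φp‖ ∧ ‖inner ℂ (a 0) φp‖ = ‖inner ℂ (b 0) ψp‖ ∧
    ‖inner ℂ (a 0) φp‖ < 1 ∧
    S₀ = rays {Ψ | ∃ α : ℝ,
      Ψ = (√l₁ : ℂ) • prodKet (a 0) (b 0)
        + exp (α * I) •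
          ((√l₁ : ℂ) • prodKet (a 1) (b 1) + (√l₂ : ℂ) • prodKet (a 2) (b 2))} ∧
    S₁ = rays {Ψ | ∃ β : ℝ,
      Ψ = (√l₁ : ℂ) • (prodKet φm ψm + exp (β * I) • prodKet φp ψp)
        + (√l₂ : ℂ) • prodKet (a 2) (b 2)}

/-- Up to global phases, `S₀` is the family `(|00⟩ + e^{iα}(|11⟩ + |22⟩))/√3`, and `Ψ'` is the state
`1/√3` times `cos(θ/2)|00⟩ + sin(θ/2)(e^{iφ₀}|10⟩ + e^{iφ₁}|0⟩|ψ⁺⟩)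
 + e^{i(φ₀+φ₁)}(e^{iη}|2⟩|ψ⁻⟩ - cos(θ/2)|1⟩|ψ⁺⟩)`, where `θ ∈ (0,π]`, `ψ^±` is an orthonormal basis
of `span{|1⟩,|2⟩}` in the second factor, and `|⟨1|ψ⁺⟩| ≠ 1`. -/
def FormIII (S₀ : Set (EuclideanSpace ℂ (ιA × ιB))) (Ψ' : EuclideanSpace ℂ (ιA × ιB)) : Prop :=
  ∃ (a : Fin 3 → EuclideanSpace ℂ ιA) (b : Fin 3 → EuclideanSpace ℂ ιB)
    (ψp ψm : EuclideanSpace ℂ ιB) (θ φ₀ φ₁ η : ℝ),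
    Orthonormal ℂ a ∧ Orthonormal ℂ b ∧
    Orthonormal ℂ ![ψp, ψm] ∧ Submodule.span ℂ {ψp, ψm} = Submodule.span ℂ {b 1, b 2} ∧
    ‖inner ℂ (b 1) ψp‖ ≠ 1 ∧ 0 < θ ∧ θ ≤ Real.pi ∧
    S₀ = rays {Ψ | ∃ α : ℝ,
      Ψ = ((√3)⁻¹ : ℂ) • (prodKet (a 0) (b 0)
        + exp (α * I) • (prodKet (a 1) (b 1) + prodKet (a 2) (b 2)))} ∧
    Ψ' = ((√3)⁻¹ : ℂ) • ((Real.cos (θ / 2) : ℂ) • prodKet (a 0) (b 0)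
        + (Real.sin (θ / 2) : ℂ) •
          (exp (φ₀ * I) • prodKet (a 1) (b 0) + exp (φ₁ * I) • prodKet (a 0) ψp)
        + exp ((φ₀ + φ₁) * I) •
          (exp (η * I) • prodKet (a 2) ψm - (Real.cos (θ / 2) : ℂ) • prodKet (a 1) ψp))

/-- Type I: a three-dimensional Schmidt hyperdisk. -/
def IsTypeI (T : Set (EuclideanSpace ℂ (ιA × ιB))) : Prop :=
  IsSchmidtHyperdisk 3 T ∧ FormI T

/-- Type II: the union of two two-dimensional subhyperdisks of different Schmidt hyperdisks. -/
def IsTypeII (T : Set (EuclideanSpace ℂ (ιA × ιB))) : Prop :=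
  ∃ S₀ S₁ : Set (EuclideanSpace ℂ (ιA × ιB)),
    T = S₀ ∪ S₁ ∧
    (∃ S, IsSchmidtHyperdisk 3 S ∧ IsSubhyperdisk 2 S₀ S) ∧
    (∃ S, IsSchmidtHyperdisk 3 S ∧ IsSubhyperdisk 2 S₁ S) ∧
    OnDifferentSchmidtHyperdisks S₀ S₁ ∧
    FormII S₀ S₁

/-- Type III: the union of a two-dimensional subhyperdisk of a Schmidt hyperdisk and of a single
state that lies on another Schmidt hyperdisk. -/
def IsTypeIII (T : Set (EuclideanSpace ℂ (ιA × ιB))) : Prop :=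
  ∃ (S₀ : Set (EuclideanSpace ℂ (ιA × ιB))) (Ψ' : EuclideanSpace ℂ (ιA × ιB)),
    T = S₀ ∪ rays {Ψ'} ∧
    (∃ S, IsSchmidtHyperdisk 3 S ∧ IsSubhyperdisk 2 S₀ S) ∧
    (∃ S, IsSchmidtHyperdisk 3 S ∧ Ψ' ∈ S) ∧
    OnDifferentSchmidtHyperdisks S₀ {Ψ'} ∧
    FormIII S₀ Ψ'

end Bipartite

end Masking

end

noncomputable section

namespace Masking

open Complex Matrix
open scoped ComplexOrder

set_option linter.unusedSectionVars false

variable {ιA ιB : Type*} [Fintype ιA] [Fintype ιB]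

local notation "conj" => starRingEnd ℂ

/-! Fix orthonormal triples in the two factors. A vector of their product span is a 3×3 matrix `m`,
and its marginals are the Gram matrices `m * mᴴ` and `mᴴ * m`, up to a transpose. A two-dimensional
subhyperdisk of a Schmidt hyperdisk splits the three Schmidt terms into two groups, one of which is
a single term (`exists_standard_form`). In suitable bases the span of the target set therefore
contains `|00⟩` and `r₁|11⟩ + r₂|22⟩`, and both marginals are `diag(r_j²)`. As the span has
dimension three, one more target state `X` completes it, and the target states are exactly the
matrices of this linear pencil with both Gram matrices equal to `diag(r_j²)`
(`IsMaskingMachine.exists_eq_targetSet`).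

The rest is matrix algebra (`targetSet_classification`). A matrix with these marginals commutes with
`diag(r_j²)`, so `X i j` can be nonzero only if `r i = r j`. If `X` does not mix index 0 with the
others, it can be diagonalised by a common rotation of the indices 1 and 2. The pencil then consists
of all diagonal matrices, and the target set is the whole Schmidt hyperdisk: type I.

If `X` mixes index 0 with exactly one other index, the mixed 2×2 block differs from a diagonal
multiple of a unitary by a rank-one matrix. The admissible pencil parameters off the base disk then
lie on a circle, which yields a second disk: type II. The remaining case needs `r 0 = r 1 = r 2`.
After a rotation `X 2 0 = 0`. If `X 0 2` vanishes too, type II applies again. Otherwise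
orthogonality of the columns leaves only the multiples of `X` by a phase outside the base disk: type
III.

To see that the pieces lie on different Schmidt hyperdisks, the identity `M N† K = K N† M` is used.
It holds on any Schmidt hyperdisk and does not refer to its bases. -/

/-! ### Bipartite vectors as coefficient matrices. -/

/-- The vector with coefficient matrix `m` in the product family `|a_i⟩|b_j⟩`. -/
def ket (a : Fin 3 → EuclideanSpace ℂ ιA) (b : Fin 3 → EuclideanSpace ℂ ιB)
    (m : Matrix (Fin 3) (Fin 3) ℂ) : EuclideanSpace ℂ (ιA × ιB) :=
  ∑ i, ∑ j, m i j • prodKet (a i) (b j)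

/-- The matrix whose columns are the vectors `a_i`. -/
def colMatrix (a : Fin 3 → EuclideanSpace ℂ ιA) : Matrix ιA (Fin 3) ℂ :=
  Matrix.of fun p i => a i p

/-- The coefficient matrix of a bipartite vector. -/
def toMatrix (Ψ : EuclideanSpace ℂ (ιA × ιB)) : Matrix ιA ιB ℂ :=
  Matrix.of fun p q => Ψ (p, q)

theorem toMatrix_injective :
    Function.Injective (toMatrix : EuclideanSpace ℂ (ιA × ιB) → Matrix ιA ιB ℂ) := by
  intro Ψ Φ h
  ext p
  exact congrFun (congrFun h p.1) p.2

@[simp] theorem prodKet_apply (a : EuclideanSpace ℂ ιA) (b : EuclideanSpace ℂ ιB) (p : ιA × ιB) :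
    prodKet a b p = a p.1 * b p.2 := rfl

theorem ket_apply (a : Fin 3 → EuclideanSpace ℂ ιA) (b : Fin 3 → EuclideanSpace ℂ ιB)
    (m : Matrix (Fin 3) (Fin 3) ℂ) (p : ιA × ιB) :
    ket a b m p = ∑ i, ∑ j, m i j * (a i p.1 * b j p.2) := by
  simp [ket]

theorem ket_add (a : Fin 3 → EuclideanSpace ℂ ιA) (b : Fin 3 → EuclideanSpace ℂ ιB)
    (m n : Matrix (Fin 3) (Fin 3) ℂ) : ket a b (m + n) = ket a b m + ket a b n := by
  simp [ket, add_smul, Finset.sum_add_distrib]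

theorem ket_smul (a : Fin 3 → EuclideanSpace ℂ ιA) (b : Fin 3 → EuclideanSpace ℂ ιB)
    (c : ℂ) (m : Matrix (Fin 3) (Fin 3) ℂ) : ket a b (c • m) = c • ket a b m := by
  simp [ket, Finset.smul_sum, mul_smul]

theorem ket_diagonal (a : Fin 3 → EuclideanSpace ℂ ιA) (b : Fin 3 → EuclideanSpace ℂ ιB)
    (d : Fin 3 → ℂ) : ket a b (diagonal d) = ∑ j, d j • prodKet (a j) (b j) := by
  simp [ket, diagonal_apply, ite_smul]

theorem toMatrix_ket (a : Fin 3 → EuclideanSpace ℂ ιA) (b : Fin 3 → EuclideanSpace ℂ ιB)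
    (m : Matrix (Fin 3) (Fin 3) ℂ) :
    toMatrix (ket a b m) = colMatrix a * m * (colMatrix b)ᵀ := by
  ext p q
  simp only [toMatrix, of_apply, ket_apply, colMatrix, mul_apply, transpose_apply, Finset.sum_mul]
  rw [Finset.sum_comm]
  refine Finset.sum_congr rfl fun i _ => Finset.sum_congr rfl fun j _ => ?_
  ring

theorem conjTranspose_mul_colMatrix {a : Fin 3 → EuclideanSpace ℂ ιA} (ha : Orthonormal ℂ a) :
    (colMatrix a)ᴴ * colMatrix a = 1 := by
  ext i j
  have h := (orthonormal_iff_ite.mp ha) i j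
  rw [PiLp.inner_apply] at h
  simp only [RCLike.inner_apply] at h
  rw [one_apply, ← h, mul_apply]
  refine Finset.sum_congr rfl fun p _ => ?_
  simp [colMatrix, mul_comm]

theorem transpose_mul_conj_colMatrix {a : Fin 3 → EuclideanSpace ℂ ιA} (ha : Orthonormal ℂ a) :
    (colMatrix a)ᵀ * (colMatrix a)ᴴᵀ = 1 := by
  rw [← transpose_mul, conjTranspose_mul_colMatrix ha, transpose_one]

theorem orthonormal_of_conjTranspose_mul {a : Fin 3 → EuclideanSpace ℂ ιA}
    (h : (colMatrix a)ᴴ * colMatrix a = 1) : Orthonormal ℂ a := by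
  rw [orthonormal_iff_ite]
  intro i j
  have h' := congrFun (congrFun h i) j
  rw [one_apply, mul_apply] at h'
  rw [← h', PiLp.inner_apply]
  refine Finset.sum_congr rfl fun p _ => ?_
  simp [colMatrix, mul_comm]

theorem traceB_ketBra (Ψ : EuclideanSpace ℂ (ιA × ιB)) :
    traceB (ketBra Ψ) = toMatrix Ψ * (toMatrix Ψ)ᴴ := by
  ext i j
  simp [traceB, ketBra, toMatrix, mul_apply]

theorem traceA_ketBra (Ψ : EuclideanSpace ℂ (ιA × ιB)) :
    traceA (ketBra Ψ) = ((toMatrix Ψ)ᴴ * toMatrix Ψ)ᵀ := by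
  ext i j
  simp [traceA, ketBra, toMatrix, mul_apply, mul_comm]

theorem conjTranspose_toMatrix_ket (a : Fin 3 → EuclideanSpace ℂ ιA)
    (b : Fin 3 → EuclideanSpace ℂ ιB) (m : Matrix (Fin 3) (Fin 3) ℂ) :
    (toMatrix (ket a b m))ᴴ = (colMatrix b)ᴴᵀ * mᴴ * (colMatrix a)ᴴ := by
  rw [toMatrix_ket, conjTranspose_mul, conjTranspose_mul, ← Matrix.mul_assoc]
  rfl

/-- The `toMatrix` of a ket, multiplied by the adjoint of another one and by a third one. -/
theorem toMatrix_ket_triple {a : Fin 3 → EuclideanSpace ℂ ιA} {b : Fin 3 → EuclideanSpace ℂ ιB}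
    (ha : Orthonormal ℂ a) (hb : Orthonormal ℂ b) (m n k : Matrix (Fin 3) (Fin 3) ℂ) :
    toMatrix (ket a b m) * (toMatrix (ket a b n))ᴴ * toMatrix (ket a b k)
      = toMatrix (ket a b (m * nᴴ * k)) := by
  have h1 := conjTranspose_mul_colMatrix ha
  have h2 := transpose_mul_conj_colMatrix hb
  rw [conjTranspose_toMatrix_ket, toMatrix_ket, toMatrix_ket, toMatrix_ket]
  calc _ = colMatrix a * m * ((colMatrix b)ᵀ * (colMatrix b)ᴴᵀ) * nᴴ
        * ((colMatrix a)ᴴ * colMatrix a) * k * (colMatrix b)ᵀ := by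
        simp only [Matrix.mul_assoc]
    _ = _ := by rw [h1, h2]; simp only [Matrix.mul_assoc, Matrix.mul_one]

theorem colMatrix_sandwich {a : Fin 3 → EuclideanSpace ℂ ιA} {b : Fin 3 → EuclideanSpace ℂ ιB}
    (ha : Orthonormal ℂ a) (hb : Orthonormal ℂ b) (m : Matrix (Fin 3) (Fin 3) ℂ) :
    (colMatrix a)ᴴ * (colMatrix a * m * (colMatrix b)ᵀ) * (colMatrix b)ᴴᵀ = m := by
  calc _ = ((colMatrix a)ᴴ * colMatrix a) * m * ((colMatrix b)ᵀ * (colMatrix b)ᴴᵀ) := by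
        simp only [Matrix.mul_assoc]
    _ = m := by
      rw [conjTranspose_mul_colMatrix ha, transpose_mul_conj_colMatrix hb, Matrix.one_mul,
        Matrix.mul_one]

theorem ket_injective {a : Fin 3 → EuclideanSpace ℂ ιA} {b : Fin 3 → EuclideanSpace ℂ ιB}
    (ha : Orthonormal ℂ a) (hb : Orthonormal ℂ b) : Function.Injective (ket a b) := by
  intro m n h
  rw [← colMatrix_sandwich ha hb m, ← colMatrix_sandwich ha hb n, ← toMatrix_ket, h, toMatrix_ket]

theorem traceB_ketBra_ket {a : Fin 3 → EuclideanSpace ℂ ιA} {b : Fin 3 → EuclideanSpace ℂ ιB}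
    (hb : Orthonormal ℂ b) (m : Matrix (Fin 3) (Fin 3) ℂ) :
    traceB (ketBra (ket a b m)) = colMatrix a * (m * mᴴ) * (colMatrix a)ᴴ := by
  rw [traceB_ketBra, conjTranspose_toMatrix_ket, toMatrix_ket]
  calc _ = colMatrix a * m * ((colMatrix b)ᵀ * (colMatrix b)ᴴᵀ) * mᴴ * (colMatrix a)ᴴ := by
        simp only [Matrix.mul_assoc]
    _ = _ := by
      rw [transpose_mul_conj_colMatrix hb]; simp only [Matrix.mul_assoc, Matrix.one_mul]

theorem traceA_ketBra_ket {a : Fin 3 → EuclideanSpace ℂ ιA} {b : Fin 3 → EuclideanSpace ℂ ιB}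
    (ha : Orthonormal ℂ a) (m : Matrix (Fin 3) (Fin 3) ℂ) :
    traceA (ketBra (ket a b m)) = colMatrix b * (mᴴ * m)ᵀ * (colMatrix b)ᴴ := by
  rw [traceA_ketBra, conjTranspose_toMatrix_ket, toMatrix_ket]
  have : (colMatrix b)ᴴᵀ * mᴴ * (colMatrix a)ᴴ * (colMatrix a * m * (colMatrix b)ᵀ)
      = (colMatrix b)ᴴᵀ * (mᴴ * ((colMatrix a)ᴴ * colMatrix a) * m) * (colMatrix b)ᵀ := by
    simp only [Matrix.mul_assoc]
  rw [this, conjTranspose_mul_colMatrix ha, Matrix.mul_one, transpose_mul, transpose_mul,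
    transpose_transpose, transpose_transpose, Matrix.mul_assoc]

/-- The coefficient matrix `m` has both Gram matrices equal to `diag(r_j²)`. -/
def HasMarginals (r : Fin 3 → ℝ) (m : Matrix (Fin 3) (Fin 3) ℂ) : Prop :=
  m * mᴴ = diagonal (fun j => (r j : ℂ) ^ 2) ∧ mᴴ * m = diagonal (fun j => (r j : ℂ) ^ 2)

theorem colMatrix_conj_injective {a : Fin 3 → EuclideanSpace ℂ ιA} (ha : Orthonormal ℂ a)
    {m n : Matrix (Fin 3) (Fin 3) ℂ}
    (h : colMatrix a * m * (colMatrix a)ᴴ = colMatrix a * n * (colMatrix a)ᴴ) : m = n := by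
  have key : ∀ k : Matrix (Fin 3) (Fin 3) ℂ,
      (colMatrix a)ᴴ * (colMatrix a * k * (colMatrix a)ᴴ) * colMatrix a = k := fun k => by
    calc _ = ((colMatrix a)ᴴ * colMatrix a) * k * ((colMatrix a)ᴴ * colMatrix a) := by
          simp only [Matrix.mul_assoc]
      _ = k := by rw [conjTranspose_mul_colMatrix ha, Matrix.one_mul, Matrix.mul_one]
  rw [← key m, h, key n]

theorem hasMarginals_iff {a : Fin 3 → EuclideanSpace ℂ ιA} {b : Fin 3 → EuclideanSpace ℂ ιB}
    (ha : Orthonormal ℂ a) (hb : Orthonormal ℂ b) (r : Fin 3 → ℝ)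
    (m : Matrix (Fin 3) (Fin 3) ℂ) :
    HasMarginals r m ↔
      traceB (ketBra (ket a b m))
          = colMatrix a * diagonal (fun j => (r j : ℂ) ^ 2) * (colMatrix a)ᴴ ∧
        traceA (ketBra (ket a b m))
          = colMatrix b * diagonal (fun j => (r j : ℂ) ^ 2) * (colMatrix b)ᴴ := by
  rw [traceB_ketBra_ket hb, traceA_ketBra_ket ha]
  constructor
  · rintro ⟨h1, h2⟩
    rw [h1, h2, diagonal_transpose]
    exact ⟨rfl, rfl⟩
  · rintro ⟨h1, h2⟩
    refine ⟨colMatrix_conj_injective ha h1, ?_⟩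
    have := colMatrix_conj_injective hb h2
    rw [← transpose_transpose (mᴴ * m), this, diagonal_transpose]

/-- The complementary projection `1 - A * Aᴴ` annihilates `M * Mᴴ`, hence annihilates `M`: the
columns of `M` lie in the support of the marginal. -/
theorem eq_projection_mul {ι κ : Type*} [Fintype ι] [Fintype κ] [DecidableEq ι]
    {A : Matrix ι (Fin 3) ℂ}
    (hA : Aᴴ * A = 1) (L : Matrix (Fin 3) (Fin 3) ℂ) (M : Matrix ι κ ℂ)
    (h : M * Mᴴ = A * L * Aᴴ) : M = A * Aᴴ * M := by
  have h0 : (1 - A * Aᴴ) * A = 0 := by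
    rw [Matrix.sub_mul, Matrix.mul_assoc, hA, Matrix.one_mul, Matrix.mul_one, sub_self]
  have h1 : ((1 - A * Aᴴ) * M) * ((1 - A * Aᴴ) * M)ᴴ = 0 := by
    rw [conjTranspose_mul, Matrix.mul_assoc, ← Matrix.mul_assoc M, h]
    simp only [← Matrix.mul_assoc]
    rw [h0]
    simp only [Matrix.zero_mul]
  have h2 := Matrix.self_mul_conjTranspose_eq_zero.mp h1
  rw [Matrix.sub_mul, Matrix.one_mul, sub_eq_zero] at h2
  exact h2

/-- A vector with the marginals of a Schmidt hyperdisk lies in the span of its local bases. -/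
theorem exists_eq_ket {a : Fin 3 → EuclideanSpace ℂ ιA} {b : Fin 3 → EuclideanSpace ℂ ιB}
    (ha : Orthonormal ℂ a) (hb : Orthonormal ℂ b) (L : Matrix (Fin 3) (Fin 3) ℂ)
    {Ψ : EuclideanSpace ℂ (ιA × ιB)}
    (h1 : traceB (ketBra Ψ) = colMatrix a * L * (colMatrix a)ᴴ)
    (h2 : traceA (ketBra Ψ) = colMatrix b * L * (colMatrix b)ᴴ) : ∃ m, Ψ = ket a b m := by
  classical
  rw [traceB_ketBra] at h1
  rw [traceA_ketBra, transpose_mul] at h2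
  have e1 := eq_projection_mul (conjTranspose_mul_colMatrix ha) L _ h1
  have e2 := eq_projection_mul (conjTranspose_mul_colMatrix hb) L (toMatrix Ψ)ᵀ h2
  refine ⟨(colMatrix a)ᴴ * toMatrix Ψ * (colMatrix b)ᴴᵀ, toMatrix_injective ?_⟩
  rw [toMatrix_ket]
  have e3 := congrArg transpose e2
  rw [transpose_transpose, transpose_mul, transpose_mul, transpose_transpose] at e3
  calc toMatrix Ψ = colMatrix a * (colMatrix a)ᴴ * toMatrix Ψ := e1
    _ = colMatrix a * (colMatrix a)ᴴ * (toMatrix Ψ * ((colMatrix b)ᴴᵀ * (colMatrix b)ᵀ)) := by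
        rw [← e3]
    _ = _ := by simp only [Matrix.mul_assoc]

/-- The family `∑ k, G k i • a k`. -/
def rotate (a : Fin 3 → EuclideanSpace ℂ ιA) (G : Matrix (Fin 3) (Fin 3) ℂ) :
    Fin 3 → EuclideanSpace ℂ ιA :=
  fun i => ∑ k, G k i • a k

theorem colMatrix_rotate (a : Fin 3 → EuclideanSpace ℂ ιA) (G : Matrix (Fin 3) (Fin 3) ℂ) :
    colMatrix (rotate a G) = colMatrix a * G := by
  ext p i
  simp [colMatrix, rotate, mul_apply, mul_comm]

theorem orthonormal_rotate {a : Fin 3 → EuclideanSpace ℂ ιA} (ha : Orthonormal ℂ a)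
    {G : Matrix (Fin 3) (Fin 3) ℂ} (hG : Gᴴ * G = 1) : Orthonormal ℂ (rotate a G) := by
  apply orthonormal_of_conjTranspose_mul
  rw [colMatrix_rotate, conjTranspose_mul, Matrix.mul_assoc, ← Matrix.mul_assoc _ _ G,
    conjTranspose_mul_colMatrix ha, Matrix.one_mul, hG]

/-- The second family enters through a transposed column matrix, so right multiplication by `Hᴴ`
corresponds to rotating `b` by the entrywise conjugate `Hᴴᵀ`. -/
theorem ket_rotate (a : Fin 3 → EuclideanSpace ℂ ιA) (b : Fin 3 → EuclideanSpace ℂ ιB)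
    (G H m : Matrix (Fin 3) (Fin 3) ℂ) :
    ket (rotate a G) (rotate b Hᴴᵀ) m = ket a b (G * m * Hᴴ) := by
  apply toMatrix_injective
  rw [toMatrix_ket, toMatrix_ket, colMatrix_rotate, colMatrix_rotate, transpose_mul,
    transpose_transpose]
  simp only [Matrix.mul_assoc]

theorem conj_conjTranspose_mul {H : Matrix (Fin 3) (Fin 3) ℂ} (hH : Hᴴ * H = 1) :
    (Hᴴᵀ)ᴴ * Hᴴᵀ = 1 := by
  have h : (Hᴴᵀ)ᴴ = Hᵀ := by
    ext i j; simp
  rw [h, ← transpose_mul, hH, transpose_one]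

theorem inner_ket {a : Fin 3 → EuclideanSpace ℂ ιA} {b : Fin 3 → EuclideanSpace ℂ ιB}
    (ha : Orthonormal ℂ a) (hb : Orthonormal ℂ b) (m n : Matrix (Fin 3) (Fin 3) ℂ) :
    inner ℂ (ket a b m) (ket a b n) = trace (mᴴ * n) := by
  have h : inner ℂ (ket a b m) (ket a b n)
      = trace ((toMatrix (ket a b m))ᴴ * toMatrix (ket a b n)) := by
    rw [PiLp.inner_apply, Fintype.sum_prod_type, Finset.sum_comm]
    simp [trace, toMatrix, mul_apply, mul_comm]
  rw [h, conjTranspose_toMatrix_ket, toMatrix_ket]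
  calc _ = trace ((colMatrix b)ᴴᵀ * (mᴴ * ((colMatrix a)ᴴ * colMatrix a) * n
        * (colMatrix b)ᵀ)) := by simp only [Matrix.mul_assoc]
    _ = trace (mᴴ * n * ((colMatrix b)ᵀ * (colMatrix b)ᴴᵀ)) := by
        rw [trace_mul_comm, conjTranspose_mul_colMatrix ha, Matrix.mul_one]
        simp only [Matrix.mul_assoc]
    _ = _ := by rw [transpose_mul_conj_colMatrix hb, Matrix.mul_one]

/-! ### Entrywise consequences of prescribed marginals. -/

theorem HasMarginals.row {r : Fin 3 → ℝ} {m : Matrix (Fin 3) (Fin 3) ℂ} (h : HasMarginals r m)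
    (i j : Fin 3) :
    m i 0 * conj (m j 0) + m i 1 * conj (m j 1) + m i 2 * conj (m j 2)
      = if i = j then (r i : ℂ) ^ 2 else 0 := by
  have := congrFun (congrFun h.1 i) j
  simpa [mul_apply, Fin.sum_univ_three, diagonal_apply] using this

theorem HasMarginals.col {r : Fin 3 → ℝ} {m : Matrix (Fin 3) (Fin 3) ℂ} (h : HasMarginals r m)
    (i j : Fin 3) :
    conj (m 0 i) * m 0 j + conj (m 1 i) * m 1 j + conj (m 2 i) * m 2 j
      = if i = j then (r i : ℂ) ^ 2 else 0 := by
  have := congrFun (congrFun h.2 i) j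
  simpa [mul_apply, Fin.sum_univ_three, diagonal_apply] using this

theorem HasMarginals.row_norm {r : Fin 3 → ℝ} {m : Matrix (Fin 3) (Fin 3) ℂ}
    (h : HasMarginals r m) (i : Fin 3) :
    ‖m i 0‖ ^ 2 + ‖m i 1‖ ^ 2 + ‖m i 2‖ ^ 2 = r i ^ 2 := by
  have := h.row i i
  simp only [mul_conj', if_true] at this
  exact_mod_cast this

theorem HasMarginals.col_norm {r : Fin 3 → ℝ} {m : Matrix (Fin 3) (Fin 3) ℂ}
    (h : HasMarginals r m) (i : Fin 3) :
    ‖m 0 i‖ ^ 2 + ‖m 1 i‖ ^ 2 + ‖m 2 i‖ ^ 2 = r i ^ 2 := by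
  have := h.col i i
  simp only [conj_mul', if_true] at this
  exact_mod_cast this

/-- A coefficient matrix with both marginals `diag(r_j²)` commutes with `diag(r_j²)`. -/
theorem HasMarginals.apply_eq_zero {r : Fin 3 → ℝ} (hr : ∀ j, 0 < r j)
    {m : Matrix (Fin 3) (Fin 3) ℂ} (h : HasMarginals r m) {i j : Fin 3} (hij : r i ≠ r j) :
    m i j = 0 := by
  -- Both sides equal `m * mᴴ * m`.
  have h1 : m * diagonal (fun j => (r j : ℂ) ^ 2) = diagonal (fun j => (r j : ℂ) ^ 2) * m := by
    rw [← h.1, Matrix.mul_assoc, h.2, h.1]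
  have h2 := congrFun (congrFun h1 i) j
  rw [mul_diagonal, diagonal_mul] at h2
  by_contra h0
  apply hij
  have h3 : ((r j : ℂ)) ^ 2 = (r i : ℂ) ^ 2 := by
    apply mul_left_cancel₀ h0; rw [h2]; ring
  have h4 : r j ^ 2 = r i ^ 2 := by exact_mod_cast h3
  exact ((pow_left_inj₀ (hr j).le (hr i).le two_ne_zero).mp h4).symm

theorem HasMarginals.smul {r : Fin 3 → ℝ} {m : Matrix (Fin 3) (Fin 3) ℂ}
    (h : HasMarginals r m) {c : ℂ} (hc : ‖c‖ = 1) : HasMarginals r (c • m) := by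
  have e : c * conj c = 1 := by rw [mul_conj', hc]; simp
  have e' : conj c * c = 1 := by rw [mul_comm, e]
  refine ⟨?_, ?_⟩
  · rw [conjTranspose_smul, Matrix.smul_mul, Matrix.mul_smul, smul_smul]
    change (c * conj c) • _ = _
    rw [e, one_smul, h.1]
  · rw [conjTranspose_smul, Matrix.smul_mul, Matrix.mul_smul, smul_smul]
    change (conj c * c) • _ = _
    rw [e', one_smul, h.2]

theorem hasMarginals_diagonal_iff (r : Fin 3 → ℝ) (hr : ∀ j, 0 < r j) (d : Fin 3 → ℂ) :
    HasMarginals r (diagonal d) ↔ ∀ j, ‖d j‖ = r j := by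
  constructor
  · intro h j
    have := h.row_norm j
    rw [← pow_left_inj₀ (norm_nonneg _) (hr j).le two_ne_zero, ← this]
    fin_cases j <;> simp
  · intro h
    constructor
    · rw [diagonal_conjTranspose, diagonal_mul_diagonal]
      congr 1
      ext j
      simp [mul_conj', h]
    · rw [diagonal_conjTranspose, diagonal_mul_diagonal]
      congr 1
      ext j
      simp [conj_mul', h]

theorem HasMarginals.conj_unitary {r : Fin 3 → ℝ} {m : Matrix (Fin 3) (Fin 3) ℂ}
    (h : HasMarginals r m) {G H : Matrix (Fin 3) (Fin 3) ℂ} (hG : Gᴴ * G = 1) (hH : Hᴴ * H = 1)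
    (hGr : G * diagonal (fun j => (r j : ℂ) ^ 2) = diagonal (fun j => (r j : ℂ) ^ 2) * G)
    (hHr : H * diagonal (fun j => (r j : ℂ) ^ 2) = diagonal (fun j => (r j : ℂ) ^ 2) * H) :
    HasMarginals r (G * m * Hᴴ) := by
  have hG' := mul_eq_one_comm.mp hG
  have hH' := mul_eq_one_comm.mp hH
  constructor
  · calc G * m * Hᴴ * (G * m * Hᴴ)ᴴ = G * (m * (Hᴴ * H) * mᴴ) * Gᴴ := by
          simp only [conjTranspose_mul, conjTranspose_conjTranspose, Matrix.mul_assoc]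
      _ = _ := by rw [hH, Matrix.mul_one, h.1, hGr, Matrix.mul_assoc, hG', Matrix.mul_one]
  · calc (G * m * Hᴴ)ᴴ * (G * m * Hᴴ) = H * (mᴴ * (Gᴴ * G) * m) * Hᴴ := by
          simp only [conjTranspose_mul, conjTranspose_conjTranspose, Matrix.mul_assoc]
      _ = _ := by rw [hG, Matrix.mul_one, h.2, hHr, Matrix.mul_assoc, hH', Matrix.mul_one]

/-! ### The pencil and its admissible states. -/

/-- The three-parameter family of coefficient matrices spanned by `|00⟩`, `r₁|11⟩ + r₂|22⟩`
and `X`. -/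
def pencil (r : Fin 3 → ℝ) (X : Matrix (Fin 3) (Fin 3) ℂ) (x y z : ℂ) :
    Matrix (Fin 3) (Fin 3) ℂ :=
  x • diagonal ![1, 0, 0] + y • diagonal ![0, (r 1 : ℂ), (r 2 : ℂ)] + z • X

theorem pencil_eq (r : Fin 3 → ℝ) (X : Matrix (Fin 3) (Fin 3) ℂ) (x y z : ℂ) :
    pencil r X x y z =
      !![x + z * X 0 0, z * X 0 1, z * X 0 2;
         z * X 1 0, y * r 1 + z * X 1 1, z * X 1 2;
         z * X 2 0, z * X 2 1, y * r 2 + z * X 2 2] := by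
  ext i j
  fin_cases i <;> fin_cases j <;> simp [pencil]

theorem pencil_zero (r : Fin 3 → ℝ) (X : Matrix (Fin 3) (Fin 3) ℂ) (x y : ℂ) :
    pencil r X x y 0 = diagonal ![x, y * r 1, y * r 2] := by
  ext i j
  fin_cases i <;> fin_cases j <;> simp [pencil]

theorem pencil_smul (r : Fin 3 → ℝ) (X : Matrix (Fin 3) (Fin 3) ℂ) (x y z c : ℂ) :
    pencil r X (c * x) (c * y) (c * z) = c • pencil r X x y z := by
  simp [pencil, smul_add, smul_smul]

/-- The states of the span of `|00⟩`, `r₁|11⟩ + r₂|22⟩` and `X` with marginals `diag(r_j²)`. -/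
def targetSet (a : Fin 3 → EuclideanSpace ℂ ιA) (b : Fin 3 → EuclideanSpace ℂ ιB)
    (r : Fin 3 → ℝ) (X : Matrix (Fin 3) (Fin 3) ℂ) : Set (EuclideanSpace ℂ (ιA × ιB)) :=
  {Ψ | ∃ x y z : ℂ, HasMarginals r (pencil r X x y z) ∧ Ψ = ket a b (pencil r X x y z)}

theorem targetSet_smul (a : Fin 3 → EuclideanSpace ℂ ιA) (b : Fin 3 → EuclideanSpace ℂ ιB)
    (r : Fin 3 → ℝ) (X : Matrix (Fin 3) (Fin 3) ℂ) {c : ℂ} (hc : c ≠ 0) :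
    targetSet a b r (c • X) = targetSet a b r X := by
  have h1 : ∀ x y z, pencil r (c • X) x y z = pencil r X x y (z * c) := fun x y z => by
    simp [pencil, smul_smul]
  have h2 : ∀ x y z, pencil r X x y z = pencil r (c • X) x y (z / c) := fun x y z => by
    rw [h1, div_mul_cancel₀ _ hc]
  ext Ψ
  constructor
  · rintro ⟨x, y, z, h⟩
    rw [h1] at h
    exact ⟨_, _, _, h⟩
  · rintro ⟨x, y, z, h⟩
    rw [h2] at h
    exact ⟨_, _, _, h⟩

/-- The commutation hypotheses say that the simultaneous change of both local bases fixes `|00⟩`,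
`r₁|11⟩ + r₂|22⟩` and the marginals. Only the third generator `X` changes, by conjugation. -/
theorem targetSet_rotate (a : Fin 3 → EuclideanSpace ℂ ιA) (b : Fin 3 → EuclideanSpace ℂ ιB)
    (r : Fin 3 → ℝ) (X : Matrix (Fin 3) (Fin 3) ℂ) {G : Matrix (Fin 3) (Fin 3) ℂ}
    (hG : Gᴴ * G = 1)
    (hGr : G * diagonal (fun j => (r j : ℂ) ^ 2) = diagonal (fun j => (r j : ℂ) ^ 2) * G)
    (h0 : G * diagonal ![1, 0, 0] = diagonal ![1, 0, 0] * G)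
    (h1 : G * diagonal ![0, (r 1 : ℂ), (r 2 : ℂ)] = diagonal ![0, (r 1 : ℂ), (r 2 : ℂ)] * G) :
    targetSet a b r X = targetSet (rotate a G) (rotate b Gᴴᵀ) r (Gᴴ * X * G) := by
  have hG' := mul_eq_one_comm.mp hG
  have key : ∀ x y z, pencil r X x y z = G * pencil r (Gᴴ * X * G) x y z * Gᴴ := by
    intro x y z
    simp only [pencil, Matrix.mul_add, Matrix.add_mul, Matrix.mul_smul, Matrix.smul_mul]
    rw [h0, h1, Matrix.mul_assoc _ G, Matrix.mul_assoc _ G, hG', Matrix.mul_one, Matrix.mul_one]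
    congr 2
    calc X = (G * Gᴴ) * X * (G * Gᴴ) := by rw [hG', Matrix.one_mul, Matrix.mul_one]
      _ = _ := by simp only [Matrix.mul_assoc]
  have hGH : (Gᴴ)ᴴ * Gᴴ = 1 := by rw [conjTranspose_conjTranspose, hG']
  have hGHr : Gᴴ * diagonal (fun j => (r j : ℂ) ^ 2)
      = diagonal (fun j => (r j : ℂ) ^ 2) * Gᴴ := by
    have := congrArg (fun M => Gᴴ * M * Gᴴ) hGr
    simp only [← Matrix.mul_assoc] at this
    rw [hG, Matrix.one_mul, Matrix.mul_assoc _ G, hG', Matrix.mul_one] at this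
    exact this.symm
  have key' : ∀ x y z, pencil r (Gᴴ * X * G) x y z = Gᴴ * pencil r X x y z * (Gᴴ)ᴴ := by
    intro x y z
    rw [key, conjTranspose_conjTranspose]
    calc _ = (Gᴴ * G) * pencil r (Gᴴ * X * G) x y z * (Gᴴ * G) := by
          rw [hG, Matrix.one_mul, Matrix.mul_one]
      _ = _ := by simp only [Matrix.mul_assoc]
  ext Ψ
  constructor
  · rintro ⟨x, y, z, h, rfl⟩
    refine ⟨x, y, z, ?_, ?_⟩
    · rw [key']
      exact h.conj_unitary hGH hGH hGHr hGHr
    · rw [ket_rotate, ← key]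
  · rintro ⟨x, y, z, h, rfl⟩
    refine ⟨x, y, z, ?_, ?_⟩
    · rw [key]
      exact h.conj_unitary hG hG hGr hGr
    · rw [ket_rotate, ← key]

/-! ### Schmidt hyperdisks, circles of states and the base disk. -/

/-- The states `∑ j, r_j e^{iθ_j} |a_j b_j⟩`. -/
def schmidtHyperdisk (a : Fin 3 → EuclideanSpace ℂ ιA) (b : Fin 3 → EuclideanSpace ℂ ιB)
    (r : Fin 3 → ℝ) : Set (EuclideanSpace ℂ (ιA × ιB)) :=
  {Ψ | ∃ θ : Fin 3 → ℝ, Ψ = ∑ j, ((r j : ℂ) * exp (θ j * I)) • prodKet (a j) (b j)}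

theorem isSchmidtHyperdisk_schmidtHyperdisk {a : Fin 3 → EuclideanSpace ℂ ιA}
    {b : Fin 3 → EuclideanSpace ℂ ιB} {r : Fin 3 → ℝ} (ha : Orthonormal ℂ a)
    (hb : Orthonormal ℂ b) (hr : ∀ j, 0 < r j) (hr1 : ∑ j, r j ^ 2 = 1) :
    IsSchmidtHyperdisk 3 (schmidtHyperdisk a b r) :=
  ⟨a, b, r, ha, hb, fun j => (hr j).ne', hr1, rfl⟩

theorem mem_schmidtHyperdisk_iff {a : Fin 3 → EuclideanSpace ℂ ιA}
    {b : Fin 3 → EuclideanSpace ℂ ιB} {r : Fin 3 → ℝ} (hr : ∀ j, 0 < r j)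
    {Ψ : EuclideanSpace ℂ (ιA × ιB)} :
    Ψ ∈ schmidtHyperdisk a b r ↔ ∃ d : Fin 3 → ℂ, (∀ j, ‖d j‖ = r j) ∧ Ψ = ket a b (diagonal d) := by
  constructor
  · rintro ⟨θ, rfl⟩
    refine ⟨fun j => (r j : ℂ) * exp (θ j * I), fun j => ?_, ?_⟩
    · rw [norm_mul, norm_exp_ofReal_mul_I, mul_one, norm_real, Real.norm_of_nonneg (hr j).le]
    · rw [ket_diagonal]
  · rintro ⟨d, hd, rfl⟩
    refine ⟨fun j => arg (d j), ?_⟩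
    rw [ket_diagonal]
    refine Finset.sum_congr rfl fun j _ => ?_
    rw [← hd j, norm_mul_exp_arg_mul_I]

/-- The states `u + e^{iα} v`. -/
def circle {E : Type*} [NormedAddCommGroup E] [InnerProductSpace ℂ E] (u v : E) : Set E :=
  {Ψ | ∃ α : ℝ, Ψ = u + exp (α * I) • v}

theorem mem_rays_circle_iff {E : Type*} [NormedAddCommGroup E] [InnerProductSpace ℂ E]
    {u v Ψ : E} :
    Ψ ∈ rays (circle u v) ↔ ∃ x y : ℂ, ‖x‖ = 1 ∧ ‖y‖ = 1 ∧ Ψ = x • u + y • v := by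
  constructor
  · rintro ⟨z, hz, _, ⟨α, rfl⟩, rfl⟩
    refine ⟨z, z * exp (α * I), hz, ?_, ?_⟩
    · rw [norm_mul, hz, norm_exp_ofReal_mul_I, mul_one]
    · rw [smul_add, smul_smul]
  · rintro ⟨x, y, hx, hy, rfl⟩
    have hx0 : x ≠ 0 := by rintro rfl; simp at hx
    obtain ⟨α, hα⟩ := (Complex.norm_eq_one_iff (y / x)).mp (by rw [norm_div, hx, hy, div_one])
    refine ⟨x, hx, _, ⟨α, rfl⟩, ?_⟩
    rw [hα, smul_add, smul_smul, mul_div_cancel₀ _ hx0]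

theorem isHyperdisk_rays_circle {E : Type*} [NormedAddCommGroup E] [InnerProductSpace ℂ E]
    {u v : E} (hu : u ≠ 0) (hv : v ≠ 0) (huv : inner ℂ u v = 0)
    (h1 : ‖u‖ ^ 2 + ‖v‖ ^ 2 = 1) : IsHyperdisk 2 (rays (circle u v)) := by
  have hu' : ‖u‖ ≠ 0 := norm_ne_zero_iff.mpr hu
  have hv' : ‖v‖ ≠ 0 := norm_ne_zero_iff.mpr hv
  have huc : (‖u‖ : ℂ) ≠ 0 := ofReal_ne_zero.mpr hu'
  have hvc : (‖v‖ : ℂ) ≠ 0 := ofReal_ne_zero.mpr hv'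
  have hvu : inner ℂ v u = 0 := inner_eq_zero_symm.mp huv
  have norm_comb : ∀ x y : ℂ, ‖x • u + y • v‖ ^ 2 = ‖x‖ ^ 2 * ‖u‖ ^ 2 + ‖y‖ ^ 2 * ‖v‖ ^ 2 := by
    intro x y
    have := norm_add_sq_eq_norm_sq_add_norm_sq_of_inner_eq_zero (x • u) (y • v)
      (by rw [inner_smul_left, inner_smul_right, huv]; simp)
    rw [← pow_two, ← pow_two, ← pow_two] at this
    rw [this, norm_smul, norm_smul, mul_pow, mul_pow]
  have coeff_comb : ∀ x y : ℂ,
      coeffVector ![((‖u‖ : ℂ))⁻¹ • u, ((‖v‖ : ℂ))⁻¹ • v] (x • u + y • v)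
        = ![‖x‖ * ‖u‖, ‖y‖ * ‖v‖] := by
    intro x y
    ext j
    fin_cases j
    · simp [coeffVector, huv, inner_self_eq_norm_sq_to_K]
      field_simp
      simp
    · simp [coeffVector, hvu, inner_self_eq_norm_sq_to_K]
      field_simp
      simp
  refine ⟨?_, ![((‖u‖ : ℂ))⁻¹ • u, ((‖v‖ : ℂ))⁻¹ • v], ![‖u‖, ‖v‖], ?_, ?_, ?_, ?_, ?_⟩
  · intro ψ hψ
    obtain ⟨x, y, hx, hy, rfl⟩ := mem_rays_circle_iff.mp hψ
    have := norm_comb x y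
    rw [hx, hy, one_pow, one_mul, one_mul, h1] at this
    exact (pow_eq_one_iff_of_nonneg (norm_nonneg _) two_ne_zero).mp this
  · rw [orthonormal_iff_ite]
    intro i j
    fin_cases i <;> fin_cases j <;>
      simp [inner_smul_left, inner_smul_right, huv, hvu, inner_self_eq_norm_sq_to_K, norm_smul,
        hu, hv]
  · apply le_antisymm
    · rw [Submodule.span_le]
      -- The parameters 1 and -1 on the circle already recover `u` and `v`.
      have e1 : u + v ∈ Submodule.span ℂ (rays (circle u v)) :=
        Submodule.subset_span (mem_rays_circle_iff.mpr ⟨1, 1, by simp, by simp, by simp⟩)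
      have e2 : u - v ∈ Submodule.span ℂ (rays (circle u v)) :=
        Submodule.subset_span (mem_rays_circle_iff.mpr
          ⟨1, -1, by simp, by simp, by simp [sub_eq_add_neg]⟩)
      have eu : u = (2⁻¹ : ℂ) • ((u + v) + (u - v)) := by
        module
      have mu : u ∈ Submodule.span ℂ (rays (circle u v)) := by
        have := Submodule.smul_mem _ (2⁻¹ : ℂ) (Submodule.add_mem _ e1 e2)
        rwa [← eu] at this
      have mv : v ∈ Submodule.span ℂ (rays (circle u v)) := by
        simpa using Submodule.sub_mem _ e1 mu
      rintro _ ⟨j, rfl⟩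
      fin_cases j
      · exact Submodule.smul_mem _ _ mu
      · exact Submodule.smul_mem _ _ mv
    · rw [Submodule.span_le]
      have mu : u ∈ Submodule.span ℂ (Set.range ![((‖u‖ : ℂ))⁻¹ • u, ((‖v‖ : ℂ))⁻¹ • v]) := by
        have := Submodule.smul_mem _ (‖u‖ : ℂ) (Submodule.subset_span (R := ℂ)
          (s := Set.range ![((‖u‖ : ℂ))⁻¹ • u, ((‖v‖ : ℂ))⁻¹ • v]) ⟨0, rfl⟩)
        simpa [smul_smul, huc] using this
      have mv : v ∈ Submodule.span ℂ (Set.range ![((‖u‖ : ℂ))⁻¹ • u, ((‖v‖ : ℂ))⁻¹ • v]) := by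
        have := Submodule.smul_mem _ (‖v‖ : ℂ) (Submodule.subset_span (R := ℂ)
          (s := Set.range ![((‖u‖ : ℂ))⁻¹ • u, ((‖v‖ : ℂ))⁻¹ • v]) ⟨1, rfl⟩)
        simpa [smul_smul, hvc] using this
      intro ψ hψ
      obtain ⟨x, y, hx, hy, rfl⟩ := mem_rays_circle_iff.mp hψ
      exact Submodule.add_mem _ (Submodule.smul_mem _ _ mu) (Submodule.smul_mem _ _ mv)
  · intro j
    fin_cases j
    · exact norm_pos_iff.mpr hu
    · exact norm_pos_iff.mpr hv
  · intro ψ hψ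
    obtain ⟨x, y, hx, hy, rfl⟩ := mem_rays_circle_iff.mp hψ
    rw [coeff_comb, hx, hy, one_mul, one_mul]
  · intro ξ hξ hξS hc
    apply hξS
    have c0 : ‖inner ℂ u ξ‖ = ‖u‖ ^ 2 := by
      have := congrFun hc 0
      simp [coeffVector] at this
      field_simp at this
      exact this
    have c1 : ‖inner ℂ v ξ‖ = ‖v‖ ^ 2 := by
      have := congrFun hc 1
      simp [coeffVector] at this
      field_simp at this
      exact this
    set x : ℂ := inner ℂ u ξ / (‖u‖ : ℂ) ^ 2 with hx
    set y : ℂ := inner ℂ v ξ / (‖v‖ : ℂ) ^ 2 with hy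
    have nx : ‖x‖ = 1 := by
      rw [hx, norm_div, c0]; simp [hu]
    have ny : ‖y‖ = 1 := by
      rw [hy, norm_div, c1]; simp [hv]
    refine mem_rays_circle_iff.mpr ⟨x, y, nx, ny, ?_⟩
    -- `x • u + y • v` is the projection of `ξ` to the plane of `u` and `v`. It already has norm 1,
    -- so by Pythagoras a unit vector `ξ` has no component outside the plane.
    have orth : inner ℂ (x • u + y • v) (ξ - (x • u + y • v)) = 0 := by
      have k1 : inner ℂ u ξ = x * (‖u‖ : ℂ) ^ 2 := by rw [hx]; field_simp
      have k2 : inner ℂ v ξ = y * (‖v‖ : ℂ) ^ 2 := by rw [hy]; field_simp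
      have k3 : inner ℂ u (ξ - (x • u + y • v)) = 0 := by
        rw [inner_sub_right, inner_add_right, inner_smul_right, inner_smul_right, huv,
          inner_self_eq_norm_sq_to_K, k1]
        simp
      have k4 : inner ℂ v (ξ - (x • u + y • v)) = 0 := by
        rw [inner_sub_right, inner_add_right, inner_smul_right, inner_smul_right, hvu,
          inner_self_eq_norm_sq_to_K, k2]
        simp
      rw [inner_add_left, inner_smul_left, inner_smul_left, k3, k4]
      simp
    have pyth := norm_add_sq_eq_norm_sq_add_norm_sq_of_inner_eq_zero _ _ orth
    rw [add_sub_cancel, ← pow_two, ← pow_two, hξ, norm_comb, nx, ny] at pyth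
    have : ‖ξ - (x • u + y • v)‖ = 0 := by
      apply mul_self_eq_zero.mp; linarith
    exact sub_eq_zero.mp (norm_eq_zero.mp this)

theorem inner_ket_diagonal {a : Fin 3 → EuclideanSpace ℂ ιA} {b : Fin 3 → EuclideanSpace ℂ ιB}
    (ha : Orthonormal ℂ a) (hb : Orthonormal ℂ b) (d e : Fin 3 → ℂ) :
    inner ℂ (ket a b (diagonal d)) (ket a b (diagonal e)) = ∑ j, conj (d j) * e j := by
  rw [inner_ket ha hb, diagonal_conjTranspose, diagonal_mul_diagonal, trace_diagonal]
  rfl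

theorem norm_ket_diagonal_sq {a : Fin 3 → EuclideanSpace ℂ ιA} {b : Fin 3 → EuclideanSpace ℂ ιB}
    (ha : Orthonormal ℂ a) (hb : Orthonormal ℂ b) (d : Fin 3 → ℂ) :
    ‖ket a b (diagonal d)‖ ^ 2 = ∑ j, ‖d j‖ ^ 2 := by
  have h := inner_ket_diagonal ha hb d d
  rw [inner_self_eq_norm_sq_to_K] at h
  simp only [conj_mul'] at h
  apply ofReal_injective
  push_cast
  exact h

theorem ket_diagonal_ne_zero {a : Fin 3 → EuclideanSpace ℂ ιA} {b : Fin 3 → EuclideanSpace ℂ ιB}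
    (ha : Orthonormal ℂ a) (hb : Orthonormal ℂ b) {d : Fin 3 → ℂ} (hd : d ≠ 0) :
    ket a b (diagonal d) ≠ 0 := by
  intro h
  apply hd
  have h0 : ket a b 0 = 0 := by simp [ket]
  exact diagonal_eq_zero.mp (ket_injective ha hb (h.trans h0.symm))

theorem smul_ket_diagonal_add (a : Fin 3 → EuclideanSpace ℂ ιA)
    (b : Fin 3 → EuclideanSpace ℂ ιB) (x y : ℂ) (d e : Fin 3 → ℂ) :
    x • ket a b (diagonal d) + y • ket a b (diagonal e) = ket a b (diagonal (x • d + y • e)) := by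
  rw [← ket_smul, ← ket_smul, ← ket_add, ← diagonal_smul, ← diagonal_smul, diagonal_add]
  rfl

/-- Splitting the terms of a Schmidt decomposition into two groups gives a two-dimensional
subhyperdisk of the Schmidt hyperdisk. -/
theorem isSubhyperdisk_rays_circle {a : Fin 3 → EuclideanSpace ℂ ιA}
    {b : Fin 3 → EuclideanSpace ℂ ιB} {r : Fin 3 → ℝ} (ha : Orthonormal ℂ a)
    (hb : Orthonormal ℂ b) (hr : ∀ j, 0 < r j) (hr1 : ∑ j, r j ^ 2 = 1) {d e : Fin 3 → ℂ}
    (hde : ∀ j, (d j = 0 ∧ ‖e j‖ = r j) ∨ (‖d j‖ = r j ∧ e j = 0)) (hd : d ≠ 0) (he : e ≠ 0) :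
    IsSubhyperdisk 2 (rays (circle (ket a b (diagonal d)) (ket a b (diagonal e))))
      (schmidtHyperdisk a b r) := by
  constructor
  · intro Ψ hΨ
    obtain ⟨x, y, hx, hy, rfl⟩ := mem_rays_circle_iff.mp hΨ
    rw [smul_ket_diagonal_add, mem_schmidtHyperdisk_iff hr]
    refine ⟨_, fun j => ?_, rfl⟩
    rcases hde j with ⟨h1, h2⟩ | ⟨h1, h2⟩ <;> simp [h1, h2, hx, hy]
  · refine isHyperdisk_rays_circle (ket_diagonal_ne_zero ha hb hd) (ket_diagonal_ne_zero ha hb he)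
      ?_ ?_
    · rw [inner_ket_diagonal ha hb]
      refine Finset.sum_eq_zero fun j _ => ?_
      rcases hde j with ⟨h1, h2⟩ | ⟨h1, h2⟩ <;> simp [h1, h2]
    · rw [norm_ket_diagonal_sq ha hb, norm_ket_diagonal_sq ha hb, ← Finset.sum_add_distrib, ← hr1]
      refine Finset.sum_congr rfl fun j _ => ?_
      rcases hde j with ⟨h1, h2⟩ | ⟨h1, h2⟩ <;> simp [h1, h2]

/-- The subhyperdisk of the states `r₀|00⟩ + e^{iα}(r₁|11⟩ + r₂|22⟩)`. -/
def baseDisk (a : Fin 3 → EuclideanSpace ℂ ιA) (b : Fin 3 → EuclideanSpace ℂ ιB)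
    (r : Fin 3 → ℝ) : Set (EuclideanSpace ℂ (ιA × ιB)) :=
  rays (circle (ket a b (diagonal ![(r 0 : ℂ), 0, 0]))
    (ket a b (diagonal ![0, (r 1 : ℂ), (r 2 : ℂ)])))

theorem mem_baseDisk_iff {a : Fin 3 → EuclideanSpace ℂ ιA} {b : Fin 3 → EuclideanSpace ℂ ιB}
    {r : Fin 3 → ℝ} {Ψ : EuclideanSpace ℂ (ιA × ιB)} :
    Ψ ∈ baseDisk a b r ↔ ∃ x y : ℂ, ‖x‖ = 1 ∧ ‖y‖ = 1 ∧
      Ψ = ket a b (diagonal ![x * r 0, y * r 1, y * r 2]) := by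
  rw [baseDisk, mem_rays_circle_iff]
  simp only [smul_ket_diagonal_add]
  simp

theorem isSubhyperdisk_baseDisk {a : Fin 3 → EuclideanSpace ℂ ιA}
    {b : Fin 3 → EuclideanSpace ℂ ιB} {r : Fin 3 → ℝ} (ha : Orthonormal ℂ a)
    (hb : Orthonormal ℂ b) (hr : ∀ j, 0 < r j) (hr1 : ∑ j, r j ^ 2 = 1) :
    IsSubhyperdisk 2 (baseDisk a b r) (schmidtHyperdisk a b r) := by
  refine isSubhyperdisk_rays_circle ha hb hr hr1 (fun j => ?_) (fun h => ?_) (fun h => ?_)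
  · fin_cases j
    · exact Or.inr ⟨by simp [(hr 0).le], rfl⟩
    · exact Or.inl ⟨rfl, by simp [(hr 1).le]⟩
    · exact Or.inl ⟨rfl, by simp [(hr 2).le]⟩
  · have := congrFun h 0
    simp [(hr 0).ne'] at this
  · have := congrFun h 1
    simp [(hr 1).ne'] at this

/-- The slice `z = 0` consists of diagonal matrices with `y` shared by the last two entries, and
there the marginals fix only moduli. This separates the base disk from the states that involve `X`.
-/
theorem mem_targetSet_iff {a : Fin 3 → EuclideanSpace ℂ ιA} {b : Fin 3 → EuclideanSpace ℂ ιB}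
    {r : Fin 3 → ℝ} (hr : ∀ j, 0 < r j) {X : Matrix (Fin 3) (Fin 3) ℂ}
    {Ψ : EuclideanSpace ℂ (ιA × ιB)} :
    Ψ ∈ targetSet a b r X ↔ Ψ ∈ baseDisk a b r ∨ ∃ x y z : ℂ, z ≠ 0 ∧
      HasMarginals r (pencil r X x y z) ∧ Ψ = ket a b (pencil r X x y z) := by
  constructor
  · rintro ⟨x, y, z, h, rfl⟩
    by_cases hz : z = 0
    · left
      subst hz
      rw [pencil_zero] at h ⊢
      have h' := (hasMarginals_diagonal_iff r hr _).mp h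
      have h0 : ‖x‖ = r 0 := h' 0
      have h1 : ‖y * r 1‖ = r 1 := h' 1
      rw [norm_mul, norm_real, Real.norm_of_nonneg (hr 1).le] at h1
      have hy : ‖y‖ = 1 := by
        have := (hr 1).ne'
        field_simp at h1
        exact h1
      have hr0 : (r 0 : ℂ) ≠ 0 := ofReal_ne_zero.mpr (hr 0).ne'
      refine mem_baseDisk_iff.mpr ⟨x / r 0, y, ?_, hy, ?_⟩
      · rw [norm_div, norm_real, Real.norm_of_nonneg (hr 0).le, h0, div_self (hr 0).ne']
      · rw [div_mul_cancel₀ _ hr0]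
    · exact Or.inr ⟨x, y, z, hz, h, rfl⟩
  · rintro (h | ⟨x, y, z, -, h⟩)
    · obtain ⟨x, y, hx, hy, rfl⟩ := mem_baseDisk_iff.mp h
      refine ⟨x * r 0, y, 0, ?_, ?_⟩
      · rw [pencil_zero, hasMarginals_diagonal_iff r hr]
        intro j
        fin_cases j
        · simp [hx, (hr 0).le]
        · simp [hy, (hr 1).le]
        · simp [hy, (hr 2).le]
      · rw [pencil_zero]
    · exact ⟨x, y, z, h⟩

/-! ### The obstruction to a common Schmidt hyperdisk, and type I. -/

/-- On a Schmidt hyperdisk `M N† K = K N† M` holds for the coefficient matrices. -/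
theorem IsSchmidtHyperdisk.triple_comm {S : Set (EuclideanSpace ℂ (ιA × ιB))}
    (hS : IsSchmidtHyperdisk 3 S) {a : Fin 3 → EuclideanSpace ℂ ιA}
    {b : Fin 3 → EuclideanSpace ℂ ιB} (ha : Orthonormal ℂ a) (hb : Orthonormal ℂ b)
    {m n k : Matrix (Fin 3) (Fin 3) ℂ} (hm : ket a b m ∈ S) (hn : ket a b n ∈ S)
    (hk : ket a b k ∈ S) : m * nᴴ * k = k * nᴴ * m := by
  obtain ⟨a', b', r, ha', hb', -, -, rfl⟩ := hS
  obtain ⟨θ, hm⟩ := hm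
  obtain ⟨η, hn⟩ := hn
  obtain ⟨ζ, hk⟩ := hk
  apply ket_injective ha hb
  apply toMatrix_injective
  rw [← toMatrix_ket_triple ha hb, ← toMatrix_ket_triple ha hb, hm, hn, hk]
  rw [← ket_diagonal a' b' (fun j => (r j : ℂ) * exp (θ j * I)),
    ← ket_diagonal a' b' (fun j => (r j : ℂ) * exp (η j * I)),
    ← ket_diagonal a' b' (fun j => (r j : ℂ) * exp (ζ j * I)),
    toMatrix_ket_triple ha' hb', toMatrix_ket_triple ha' hb']
  congr 2
  simp only [diagonal_conjTranspose, diagonal_mul_diagonal]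
  congr 1
  ext j
  ring

/-- Apply the triple identity to the disk points with parameters 1 and -1 and to `m`. Its `(0, j)`
entry reads `r₀² m₀ⱼ = -rⱼ² m₀ⱼ`, which is impossible for `m₀ⱼ ≠ 0`. -/
theorem onDifferentSchmidtHyperdisks_baseDisk {a : Fin 3 → EuclideanSpace ℂ ιA}
    {b : Fin 3 → EuclideanSpace ℂ ιB} {r : Fin 3 → ℝ} (ha : Orthonormal ℂ a)
    (hb : Orthonormal ℂ b) (hr : ∀ j, 0 < r j) {Y : Set (EuclideanSpace ℂ (ιA × ιB))}
    {m : Matrix (Fin 3) (Fin 3) ℂ} (hm : ket a b m ∈ Y) {j : Fin 3} (hj : j ≠ 0)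
    (hmj : m 0 j ≠ 0) : OnDifferentSchmidtHyperdisks (baseDisk a b r) Y := by
  intro S hS hsub
  have h1 : ket a b (diagonal ![(r 0 : ℂ), r 1, r 2]) ∈ S :=
    hsub (Or.inl (mem_baseDisk_iff.mpr ⟨1, 1, by simp, by simp, by simp⟩))
  have h2 : ket a b (diagonal ![(r 0 : ℂ), -r 1, -r 2]) ∈ S :=
    hsub (Or.inl (mem_baseDisk_iff.mpr ⟨1, -1, by simp, by simp, by simp⟩))
  have h3 := congrFun (congrFun (hS.triple_comm ha hb h1 h2 (hsub (Or.inr hm))) 0) j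
  rw [Matrix.mul_assoc m] at h3
  simp only [diagonal_conjTranspose, diagonal_mul_diagonal, diagonal_mul, mul_diagonal] at h3
  have key : ∀ s : ℝ, 0 < s → (r 0 : ℂ) * r 0 * m 0 j = m 0 j * (-(s : ℂ) * s) → False := by
    intro s hs h
    have h4 : m 0 j * (r 0 * r 0 + s * s : ℝ) = 0 := by
      push_cast
      linear_combination h
    have := hr 0
    rcases mul_eq_zero.mp h4 with h5 | h5
    · exact hmj h5
    · have : r 0 * r 0 + s * s = 0 := by exact_mod_cast h5
      nlinarith
  fin_cases j
  · exact hj rfl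
  · exact key (r 1) (hr 1) (by simpa using h3)
  · exact key (r 2) (hr 2) (by simpa using h3)

theorem isTypeI_schmidtHyperdisk {a : Fin 3 → EuclideanSpace ℂ ιA}
    {b : Fin 3 → EuclideanSpace ℂ ιB} {r : Fin 3 → ℝ} (ha : Orthonormal ℂ a)
    (hb : Orthonormal ℂ b) (hr : ∀ j, 0 < r j) (hr1 : ∑ j, r j ^ 2 = 1) :
    IsTypeI (schmidtHyperdisk a b r) := by
  refine ⟨isSchmidtHyperdisk_schmidtHyperdisk ha hb hr hr1, a, b, fun j => r j ^ 2, ha, hb,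
    fun j => pow_pos (hr j) 2, hr1, ?_⟩
  have hs : ∀ j, √(r j ^ 2) = r j := fun j => Real.sqrt_sq (hr j).le
  simp only [hs]
  ext Ψ
  constructor
  · rintro ⟨θ, rfl⟩
    refine ⟨exp (θ 0 * I), norm_exp_ofReal_mul_I _, _, ⟨θ 1 - θ 0, θ 2 - θ 0, rfl⟩, ?_⟩
    have h : ∀ j, exp (θ j * I) = exp (θ 0 * I) * exp ((θ j - θ 0 : ℝ) * I) := fun j => by
      rw [← exp_add]; congr 1; push_cast; ring
    rw [Fin.sum_univ_three, h 1, h 2]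
    module
  · rintro ⟨z, hz, _, ⟨θ₁, θ₂, rfl⟩, rfl⟩
    rw [mem_schmidtHyperdisk_iff hr]
    refine ⟨![z * r 0, z * (exp (θ₁ * I) * r 1), z * (exp (θ₂ * I) * r 2)], fun j => ?_, ?_⟩
    · fin_cases j
      · simp [hz, (hr 0).le]
      · simp [hz, (hr 1).le, norm_exp_ofReal_mul_I]
      · simp [hz, (hr 2).le, norm_exp_ofReal_mul_I]
    · rw [ket_diagonal, Fin.sum_univ_three]
      simp only [smul_add, smul_smul]
      rfl

/-- The hypothesis on `ξ` says that `(ξ₁, ξ₂)` is not proportional to `(r₁, r₂)`. The pencil is then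
the space of all diagonal matrices, whose admissible members form the full Schmidt hyperdisk. -/
theorem targetSet_diagonal_isTypeI {a : Fin 3 → EuclideanSpace ℂ ιA}
    {b : Fin 3 → EuclideanSpace ℂ ιB} {r : Fin 3 → ℝ} (ha : Orthonormal ℂ a)
    (hb : Orthonormal ℂ b) (hr : ∀ j, 0 < r j) (hr1 : ∑ j, r j ^ 2 = 1) {ξ : Fin 3 → ℂ}
    (hξ : ξ 1 * r 2 ≠ ξ 2 * r 1) : IsTypeI (targetSet a b r (diagonal ξ)) := by
  have h : targetSet a b r (diagonal ξ) = schmidtHyperdisk a b r := by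
    have key : ∀ x y z, pencil r (diagonal ξ) x y z
        = diagonal ![x + z * ξ 0, y * r 1 + z * ξ 1, y * r 2 + z * ξ 2] := by
      intro x y z
      rw [pencil_eq]
      ext i j
      fin_cases i <;> fin_cases j <;> simp
    ext Ψ
    rw [mem_schmidtHyperdisk_iff hr]
    constructor
    · rintro ⟨x, y, z, h, rfl⟩
      rw [key] at h ⊢
      exact ⟨_, (hasMarginals_diagonal_iff r hr _).mp h, rfl⟩
    · rintro ⟨d, hd, rfl⟩
      have hdet : ξ 1 * r 2 - ξ 2 * r 1 ≠ 0 := sub_ne_zero.mpr hξ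
      -- Cramer's rule for the entries 1 and 2; `x` then adjusts entry 0.
      set z := (d 1 * r 2 - d 2 * r 1) / (ξ 1 * r 2 - ξ 2 * r 1) with hz
      set y := (ξ 1 * d 2 - ξ 2 * d 1) / (ξ 1 * r 2 - ξ 2 * r 1) with hy
      have e : pencil r (diagonal ξ) (d 0 - z * ξ 0) y z = diagonal d := by
        rw [key]
        congr 1
        ext j
        fin_cases j
        · simp
        · simp only [hz, hy, Fin.mk_one, cons_val_one, cons_val_zero]
          field_simp
          ring
        · simp only [hz, hy, Fin.reduceFinMk, cons_val]
          field_simp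
          ring
      exact ⟨d 0 - z * ξ 0, y, z, by rwa [e, hasMarginals_diagonal_iff r hr], by rw [e]⟩
  rw [h]
  exact isTypeI_schmidtHyperdisk ha hb hr hr1

theorem baseDisk_eq (a : Fin 3 → EuclideanSpace ℂ ιA) (b : Fin 3 → EuclideanSpace ℂ ιB)
    (r : Fin 3 → ℝ) :
    baseDisk a b r = rays {Ψ | ∃ α : ℝ, Ψ = (r 0 : ℂ) • prodKet (a 0) (b 0)
      + exp (α * I) • ((r 1 : ℂ) • prodKet (a 1) (b 1) + (r 2 : ℂ) • prodKet (a 2) (b 2))} := by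
  have h0 : ket a b (diagonal ![(r 0 : ℂ), 0, 0]) = (r 0 : ℂ) • prodKet (a 0) (b 0) := by
    rw [ket_diagonal, Fin.sum_univ_three]; simp
  have h1 : ket a b (diagonal ![0, (r 1 : ℂ), (r 2 : ℂ)])
      = (r 1 : ℂ) • prodKet (a 1) (b 1) + (r 2 : ℂ) • prodKet (a 2) (b 2) := by
    rw [ket_diagonal, Fin.sum_univ_three]; simp
  rw [baseDisk, h0, h1]
  rfl

/-! ### Orthonormal pairs inside a triple, and type III. -/

theorem inner_pair {E : Type*} [NormedAddCommGroup E] [InnerProductSpace ℂ E] {a : Fin 3 → E}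
    (ha : Orthonormal ℂ a) {i j : Fin 3} (hij : i ≠ j) (x y x' y' : ℂ) :
    inner ℂ (x • a i + y • a j) (x' • a i + y' • a j) = conj x * x' + conj y * y' := by
  have h := orthonormal_iff_ite.mp ha
  simp only [inner_add_left, inner_add_right, inner_smul_left, inner_smul_right, h, hij, hij.symm,
    if_true, if_false]
  ring

theorem inner_pair_left {E : Type*} [NormedAddCommGroup E] [InnerProductSpace ℂ E] {a : Fin 3 → E}
    (ha : Orthonormal ℂ a) {i j : Fin 3} (hij : i ≠ j) (x y : ℂ) :
    inner ℂ (a i) (x • a i + y • a j) = x := by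
  have h := inner_pair ha hij 1 0 x y
  simpa using h

theorem orthonormal_pair {E : Type*} [NormedAddCommGroup E] [InnerProductSpace ℂ E]
    {a : Fin 3 → E} (ha : Orthonormal ℂ a) {i j : Fin 3} (hij : i ≠ j) {x y x' y' : ℂ}
    (h1 : conj x * x + conj y * y = 1) (h2 : conj x' * x' + conj y' * y' = 1)
    (h3 : conj x * x' + conj y * y' = 0) :
    Orthonormal ℂ ![x • a i + y • a j, x' • a i + y' • a j] := by
  have h4 : conj x' * x + conj y' * y = 0 := by
    have := congrArg conj h3
    simp only [map_add, map_mul, conj_conj, map_zero] at this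
    linear_combination this
  rw [orthonormal_iff_ite]
  intro k l
  fin_cases k <;> fin_cases l
  · simpa using (inner_pair ha hij x y x y).trans h1
  · exact (inner_pair ha hij x y x' y').trans h3
  · exact (inner_pair ha hij x' y' x y).trans h4
  · simpa using (inner_pair ha hij x' y' x' y').trans h2

theorem span_pair_eq {E : Type*} [NormedAddCommGroup E] [InnerProductSpace ℂ E] {a : Fin 3 → E}
    (ha : Orthonormal ℂ a) {i j : Fin 3} (hij : i ≠ j) {x y x' y' : ℂ}
    (h : Orthonormal ℂ ![x • a i + y • a j, x' • a i + y' • a j]) :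
    Submodule.span ℂ {x • a i + y • a j, x' • a i + y' • a j} = Submodule.span ℂ {a i, a j} := by
  have hfin : FiniteDimensional ℂ (Submodule.span ℂ {a i, a j}) :=
    FiniteDimensional.span_of_finite ℂ (Set.toFinite _)
  have hr : ∀ u v : E, Set.range ![u, v] = {u, v} := fun u v => by
    simp [Set.pair_comm]
  refine Submodule.eq_of_le_of_finrank_eq ?_ ?_
  · rw [Submodule.span_le]
    have mi : a i ∈ Submodule.span ℂ {a i, a j} := Submodule.subset_span (by simp)
    have mj : a j ∈ Submodule.span ℂ {a i, a j} := Submodule.subset_span (by simp)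
    rintro _ (rfl | rfl)
    · exact add_mem (Submodule.smul_mem _ _ mi) (Submodule.smul_mem _ _ mj)
    · exact add_mem (Submodule.smul_mem _ _ mi) (Submodule.smul_mem _ _ mj)
  · have h' : Orthonormal ℂ ![a i, a j] := by
      have := orthonormal_pair ha hij (x := 1) (y := 0) (x' := 0) (y' := 1) (by simp) (by simp)
        (by simp)
      simpa using this
    rw [← hr, ← hr, finrank_span_eq_card h.linearIndependent,
      finrank_span_eq_card h'.linearIndependent]

/-- A state with maximally mixed marginals lies on a Schmidt hyperdisk. -/
theorem exists_isSchmidtHyperdisk_mem {a : Fin 3 → EuclideanSpace ℂ ιA}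
    {b : Fin 3 → EuclideanSpace ℂ ιB} {r : Fin 3 → ℝ} (ha : Orthonormal ℂ a)
    (hb : Orthonormal ℂ b) (hr : ∀ j, 0 < r j) (hr1 : ∑ j, r j ^ 2 = 1)
    (hc : ∀ j, r j = r 0) {m : Matrix (Fin 3) (Fin 3) ℂ} (hm : HasMarginals r m) :
    ∃ S, IsSchmidtHyperdisk 3 S ∧ ket a b m ∈ S := by
  have hr0 : (r 0 : ℂ) ≠ 0 := ofReal_ne_zero.mpr (hr 0).ne'
  have hG : ((r 0 : ℂ)⁻¹ • m)ᴴ * ((r 0 : ℂ)⁻¹ • m) = 1 := by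
    rw [conjTranspose_smul, Matrix.smul_mul, Matrix.mul_smul, smul_smul, hm.2]
    ext i j
    by_cases hij : i = j
    · subst hij
      simp [hc i]
      field_simp
    · simp [hij]
  -- With equal `r j` the matrix `m` is `r 0` times a unitary. Rotating `a` by this unitary and
  -- leaving `b` alone turns `m` into `r 0` times the identity, which is a Schmidt decomposition.
  refine ⟨schmidtHyperdisk (rotate a ((r 0 : ℂ)⁻¹ • m)) (rotate b 1ᴴᵀ) r,
    isSchmidtHyperdisk_schmidtHyperdisk (orthonormal_rotate ha hG)
      (orthonormal_rotate hb (conj_conjTranspose_mul (by simp))) hr hr1, ?_⟩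
  rw [mem_schmidtHyperdisk_iff hr]
  refine ⟨fun j => (r j : ℂ), fun j => by simp [(hr j).le], ?_⟩
  rw [ket_rotate]
  congr 1
  have : (diagonal fun j => (r j : ℂ)) = (r 0 : ℂ) • (1 : Matrix (Fin 3) (Fin 3) ℂ) := by
    ext i j
    by_cases hij : i = j
    · subst hij; simp [hc i]
    · simp [hij]
  rw [this, Matrix.mul_smul, Matrix.mul_one, smul_smul, mul_inv_cancel₀ hr0]
  simp

-- With `X 2 0 = 0` and `X 0 2 ≠ 0`, orthogonality of the columns removes the components along
-- `|00⟩` and the second generator from every admissible matrix with `z ≠ 0`, so only `X` up to a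
-- phase remains. The explicit form is read off the rows of `X`: row 0 gives `ψ⁺`, row 2 gives `ψ⁻`,
-- and in row 1 the last two entries are proportional to those of row 0.
set_option maxHeartbeats 800000 in
theorem targetSet_isTypeIII_of_real {a : Fin 3 → EuclideanSpace ℂ ιA}
    {b : Fin 3 → EuclideanSpace ℂ ιB} {r : Fin 3 → ℝ} (ha : Orthonormal ℂ a)
    (hb : Orthonormal ℂ b) (hr3 : ∀ j, r j = (√3)⁻¹) {X : Matrix (Fin 3) (Fin 3) ℂ}
    (hX : HasMarginals r X) (h20 : X 2 0 = 0) (h02 : X 0 2 ≠ 0) {p : ℝ} (hp : 0 ≤ p)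
    (h00 : X 0 0 = p) : IsTypeIII (targetSet a b r X) := by
  have s3 : (0 : ℝ) < √3 := Real.sqrt_pos.mpr (by norm_num)
  have s3sq : √3 ^ 2 = 3 := Real.sq_sqrt (by norm_num)
  have hr : ∀ j, 0 < r j := fun j => by rw [hr3]; positivity
  have rsq : ∀ j, r j ^ 2 = 1 / 3 := fun j => by rw [hr3, inv_pow, s3sq]; norm_num
  have hr1 : ∑ j, r j ^ 2 = 1 := by
    rw [Fin.sum_univ_three, rsq, rsq, rsq]; norm_num
  have n02 : 0 < ‖X 0 2‖ := norm_pos_iff.mpr h02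
  have row0 := hX.row_norm 0
  have col0 := hX.col_norm 0
  have row2 := hX.row_norm 2
  have hnp : ‖(p : ℂ)‖ = p := by rw [norm_real, Real.norm_of_nonneg hp]
  rw [rsq, h00, hnp] at row0
  rw [rsq, h00, h20, hnp, norm_zero] at col0
  rw [rsq, h20, norm_zero] at row2
  have c01 := hX.col 0 1
  have c02 := hX.col 0 2
  have r02 := hX.row 0 2
  rw [h00, h20] at c01 c02 r02
  simp only [conj_ofReal, map_zero, zero_mul, add_zero, mul_zero, zero_add, Fin.isValue,
    zero_ne_one, Fin.reduceEq, if_false] at c01 c02 r02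
  have h10 : X 1 0 ≠ 0 := by
    intro h
    rw [h, norm_zero] at col0
    nlinarith [sq_nonneg ‖X 0 1‖]
  have hp3 : p ^ 2 < 1 / 3 := by
    have := norm_pos_iff.mpr h10
    nlinarith
  -- `c` and `σ` are `cos(θ/2)` and `sin(θ/2)` for `θ = 2 arccos c`; `c ≥ 0` gives `θ ≤ π` and `c <
  -- 1` gives `θ > 0`.
  set c : ℝ := √3 * p with hc
  have hc0 : 0 ≤ c := by positivity
  have hcsq : c ^ 2 = 3 * p ^ 2 := by rw [hc, mul_pow, s3sq]
  have hc1 : c < 1 := by nlinarith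
  set σ : ℝ := √(1 - c ^ 2) with hσ
  have hσsq : σ ^ 2 = 1 - c ^ 2 := Real.sq_sqrt (by nlinarith)
  have hσ0 : 0 < σ := Real.sqrt_pos.mpr (by nlinarith)
  have hcos : Real.cos (2 * Real.arccos c / 2) = c := by
    rw [mul_div_cancel_left₀ _ two_ne_zero, Real.cos_arccos (by linarith) hc1.le]
  have hsin : Real.sin (2 * Real.arccos c / 2) = σ := by
    rw [mul_div_cancel_left₀ _ two_ne_zero, Real.sin_arccos]
  have s3c : (√3 : ℂ) ≠ 0 := ofReal_ne_zero.mpr s3.ne'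
  have s3csq : (√3 : ℂ) ^ 2 = 3 := by exact_mod_cast s3sq
  have σc : (σ : ℂ) ≠ 0 := ofReal_ne_zero.mpr hσ0.ne'
  have n10 : ‖X 1 0‖ = σ / √3 := by
    rw [← pow_left_inj₀ (norm_nonneg _) (by positivity) two_ne_zero, div_pow, hσsq, s3sq, hcsq]
    linarith
  obtain ⟨φ₀, hφ₀⟩ := (Complex.norm_eq_one_iff ((√3 : ℂ) * X 1 0 / σ)).mp (by
    rw [norm_div, norm_mul, n10, norm_real, norm_real, Real.norm_of_nonneg s3.le,
      Real.norm_of_nonneg hσ0.le]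
    field_simp)
  have hmul10 : X 1 0 * conj (X 1 0) = (σ : ℂ) ^ 2 / 3 := by
    rw [mul_conj', n10]
    push_cast
    rw [div_pow, s3csq]
  have hconj10 : conj (X 1 0) ≠ 0 := (map_ne_zero _).mpr h10
  have e11 : X 1 1 = -(3 * p * X 1 0 * X 0 1) / (σ : ℂ) ^ 2 := by
    rw [eq_div_iff (pow_ne_zero 2 σc)]
    apply mul_left_cancel₀ hconj10
    linear_combination (σ : ℂ) ^ 2 * c01 + 3 * p * X 0 1 * hmul10
  have e12 : X 1 2 = -(3 * p * X 1 0 * X 0 2) / (σ : ℂ) ^ 2 := by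
    rw [eq_div_iff (pow_ne_zero 2 σc)]
    apply mul_left_cancel₀ hconj10
    linear_combination (σ : ℂ) ^ 2 * c02 + 3 * p * X 0 2 * hmul10
  -- Columns 0 and 2 give `x = 0`, because `X 2 0 = 0` makes `y` drop out. Then columns 0 and 1 give
  -- `y = 0`, and the norm of row 0 gives `‖z‖ = 1`.
  have sub : ∀ {x y z : ℂ}, z ≠ 0 → HasMarginals r (pencil r X x y z) →
      x = 0 ∧ y = 0 ∧ ‖z‖ = 1 := by
    intro x y z hz h
    have hzc : conj z ≠ 0 := (map_ne_zero _).mpr hz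
    have k2 := h.col 0 2
    have k1 := h.col 0 1
    have rn := h.row_norm 0
    rw [pencil_eq] at k1 k2 rn
    simp [h00, h20] at k1 k2 rn
    have hx : x = 0 := by
      have : conj x * z * X 0 2 = 0 := by
        linear_combination k2 - conj z * z * c02
      simpa [hz, h02] using this
    subst hx
    have hy : y = 0 := by
      have : conj z * conj (X 1 0) * (y * r 1) = 0 := by
        rw [map_zero] at k1
        linear_combination k1 - conj z * z * c01
      simpa [hz, h10, (hr 1).ne'] using this
    refine ⟨rfl, hy, ?_⟩
    rw [rsq] at rn
    simp only [zero_add, norm_mul, hnp] at rn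
    have : ‖z‖ ^ 2 = 1 := by nlinarith
    exact (pow_eq_one_iff_of_nonneg (norm_nonneg _) two_ne_zero).mp this
  have pz : ∀ z, pencil r X 0 0 z = z • X := fun z => by simp [pencil]
  refine ⟨baseDisk a b r, ket a b X, ?_, ?_, ?_, ?_, ?_⟩
  · ext Ψ
    rw [mem_targetSet_iff hr]
    refine or_congr_right ⟨?_, ?_⟩
    · rintro ⟨x, y, z, hz, h, rfl⟩
      obtain ⟨rfl, rfl, hz1⟩ := sub hz h
      exact ⟨z, hz1, _, rfl, by rw [pz, ket_smul]⟩
    · rintro ⟨z, hz1, _, rfl, rfl⟩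
      refine ⟨0, 0, z, fun h => by simp [h] at hz1, ?_, ?_⟩
      · rw [pz]; exact hX.smul hz1
      · rw [pz, ket_smul]
  · exact ⟨_, isSchmidtHyperdisk_schmidtHyperdisk ha hb hr hr1,
      isSubhyperdisk_baseDisk ha hb hr hr1⟩
  · exact exists_isSchmidtHyperdisk_mem ha hb hr hr1 (fun j => by rw [hr3, hr3]) hX
  · exact onDifferentSchmidtHyperdisks_baseDisk ha hb hr (m := X) rfl (j := 2) (by decide) h02
  · have on : Orthonormal ℂ ![(√3 / σ * X 0 1 : ℂ) • b 1 + (√3 / σ * X 0 2 : ℂ) • b 2,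
        (√3 * X 2 1 : ℂ) • b 1 + (√3 * X 2 2 : ℂ) • b 2] := by
      refine orthonormal_pair hb (by decide) ?_ ?_ ?_
      · simp only [conj_mul']
        have : ‖(√3 / σ * X 0 1 : ℂ)‖ ^ 2 + ‖(√3 / σ * X 0 2 : ℂ)‖ ^ 2 = 1 := by
          simp only [norm_mul, norm_div, norm_real, Real.norm_of_nonneg s3.le,
            Real.norm_of_nonneg hσ0.le, mul_pow, div_pow, s3sq, hσsq, hcsq]
          have : (1 - 3 * p ^ 2) ≠ 0 := by nlinarith
          field_simp
          linarith
        exact_mod_cast this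
      · simp only [conj_mul']
        have : ‖(√3 * X 2 1 : ℂ)‖ ^ 2 + ‖(√3 * X 2 2 : ℂ)‖ ^ 2 = 1 := by
          simp only [norm_mul, norm_real, Real.norm_of_nonneg s3.le, mul_pow, s3sq]
          linarith
        exact_mod_cast this
      · have r20 := congrArg conj r02
        simp only [map_add, map_mul, conj_conj, map_zero] at r20
        simp only [map_mul, map_div₀, conj_ofReal]
        linear_combination (√3 / σ * √3 : ℂ) * r20
    -- The phase `φ₁ = 0` is absorbed into `ψ⁺`. The choice `η = -φ₀` cancels the prefactor of
    -- `|2⟩|ψ⁻⟩`, so that `ψ⁻` is exactly the normalised row 2.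
    refine ⟨a, b, _, _, 2 * Real.arccos c, φ₀, 0, -φ₀, ha, hb, on, span_pair_eq hb (by decide) on,
      ?_, ?_, ?_, ?_, ?_⟩
    · rw [inner_pair_left hb (by decide)]
      intro h
      have h1 := congrArg (· ^ 2) h
      simp only [norm_mul, norm_div, norm_real, Real.norm_of_nonneg s3.le,
        Real.norm_of_nonneg hσ0.le, mul_pow, div_pow, s3sq, hσsq, hcsq, one_pow] at h1
      have : (1 - 3 * p ^ 2) ≠ 0 := by nlinarith
      field_simp at h1
      have := pow_pos n02 2
      linarith
    · have := Real.arccos_pos.mpr hc1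
      linarith
    · have := Real.arccos_le_pi_div_two.mpr hc0
      linarith
    · rw [baseDisk_eq]
      simp only [hr3, ofReal_inv]
      congr 1
      ext Ψ
      refine exists_congr fun α => ?_
      simp only [smul_add, smul_smul, mul_comm]
    · rw [hcos, hsin]
      have ex : exp (((φ₀ : ℝ) + (0 : ℝ) : ℂ) * I) = √3 * X 1 0 / σ := by
        rw [ofReal_zero, add_zero, hφ₀]
      have ex2 : exp (((φ₀ : ℝ) + (0 : ℝ) : ℂ) * I) * exp (((-φ₀ : ℝ) : ℂ) * I) = 1 := by
        rw [← exp_add, ← exp_zero]; congr 1; push_cast; ring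
      have ex3 : exp (((0 : ℝ) : ℂ) * I) = 1 := by simp
      rw [ex3, smul_sub, smul_smul (exp _) (exp _), ex2, ex, hφ₀]
      ext q
      simp only [ket_apply, Fin.sum_univ_three, PiLp.add_apply, PiLp.sub_apply, PiLp.smul_apply,
        smul_eq_mul, prodKet_apply, e11, e12, h20, h00]
      rw [hc]
      push_cast
      field_simp
      ring_nf
      simp only [s3csq]

/-- A global phase of `X` changes nothing in the target set, so `X 0 0` may be taken real and
nonnegative. -/
theorem targetSet_isTypeIII {a : Fin 3 → EuclideanSpace ℂ ιA}
    {b : Fin 3 → EuclideanSpace ℂ ιB} {r : Fin 3 → ℝ} (ha : Orthonormal ℂ a)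
    (hb : Orthonormal ℂ b) (hr3 : ∀ j, r j = (√3)⁻¹) {X : Matrix (Fin 3) (Fin 3) ℂ}
    (hX : HasMarginals r X) (h20 : X 2 0 = 0) (h02 : X 0 2 ≠ 0) :
    IsTypeIII (targetSet a b r X) := by
  have hc : ‖exp ((-arg (X 0 0) : ℝ) * I)‖ = 1 := norm_exp_ofReal_mul_I _
  rw [← targetSet_smul a b r X (exp_ne_zero ((-arg (X 0 0) : ℝ) * I))]
  refine targetSet_isTypeIII_of_real ha hb hr3 (hX.smul hc) (by simp [h20]) ?_
    (norm_nonneg (X 0 0)) ?_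
  · rw [Matrix.smul_apply, smul_eq_mul]
    exact mul_ne_zero (exp_ne_zero _) h02
  · rw [Matrix.smul_apply, smul_eq_mul]
    nth_rewrite 2 [← norm_mul_exp_arg_mul_I (X 0 0)]
    rw [mul_left_comm, ← exp_add]
    simp

/-! ### Type II. -/

/-- The unitary matrix with columns `(κ v̄₁, -v̄₀)`, `(κ v₀, v₁)` on the first two coordinates. -/
def twist (κ v₀ v₁ : ℂ) : Matrix (Fin 3) (Fin 3) ℂ :=
  !![κ * conj v₁, κ * v₀, 0; -conj v₀, v₁, 0; 0, 0, 1]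

theorem twist_unitary {κ v₀ v₁ : ℂ} (hκ : κ * conj κ = 1) (hv : v₀ * conj v₀ + v₁ * conj v₁ = 1) :
    (twist κ v₀ v₁)ᴴ * twist κ v₀ v₁ = 1 := by
  ext i j
  fin_cases i <;> fin_cases j <;>
    simp [twist, mul_apply, Fin.sum_univ_three]
  · linear_combination v₁ * conj v₁ * hκ + hv
  · linear_combination v₁ * v₀ * hκ
  · linear_combination conj v₁ * conj v₀ * hκ
  · linear_combination v₀ * conj v₀ * hκ + hv

theorem twist_comm_diagonal (κ v₀ v₁ : ℂ) {r : Fin 3 → ℝ} (h01 : r 0 = r 1) :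
    twist κ v₀ v₁ * diagonal (fun j => (r j : ℂ) ^ 2)
      = diagonal (fun j => (r j : ℂ) ^ 2) * twist κ v₀ v₁ := by
  ext i j
  rw [mul_diagonal, diagonal_mul]
  fin_cases i <;> fin_cases j <;> simp [twist, h01] <;> ring

/-- For a unit vector `v = (v₀, v₁, 0)` this is `diag(κ, 1, 1) (diag(s, s, t) + (e - 1) s |v⟩⟨v|)`:
as `e` varies, a fixed diagonal matrix is perturbed by multiples of one rank-one matrix. -/
theorem twist_mul_diagonal_mul (κ v₀ v₁ s e t : ℂ) :
    twist κ v₀ v₁ * diagonal ![s, e * s, t] * (twist 1 v₀ v₁)ᴴ =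
      !![κ * s * (conj v₁ * v₁ + e * (v₀ * conj v₀)), κ * s * v₀ * conj v₁ * (e - 1), 0;
         s * v₁ * conj v₀ * (e - 1), s * (conj v₀ * v₀ + e * (v₁ * conj v₁)), 0;
         0, 0, t] := by
  ext i j
  rw [mul_apply, Fin.sum_univ_three, mul_diagonal, mul_diagonal, mul_diagonal]
  fin_cases i <;> fin_cases j <;> simp [twist] <;> ring

theorem rotate_twist (a : Fin 3 → EuclideanSpace ℂ ιA) (κ v₀ v₁ : ℂ) :
    rotate a (twist κ v₀ v₁) =
      ![(κ * conj v₁) • a 0 + (-conj v₀) • a 1, (κ * v₀) • a 0 + v₁ • a 1, a 2] := by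
  ext i p
  fin_cases i <;> simp [rotate, twist, Fin.sum_univ_three]

theorem rotate_conj_twist (b : Fin 3 → EuclideanSpace ℂ ιB) (v₀ v₁ : ℂ) :
    rotate b (twist 1 v₀ v₁)ᴴᵀ =
      ![v₁ • b 0 + (-v₀) • b 1, (conj v₀) • b 0 + (conj v₁) • b 1, b 2] := by
  ext i p
  fin_cases i <;> simp [rotate, twist, Fin.sum_univ_three]

/-- If all states off the base disk are of the form `ζ · twist · diag(s, e s, t) · twist†`,
then the target set is of type II. -/
theorem targetSet_isTypeII_of_twist {a : Fin 3 → EuclideanSpace ℂ ιA}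
    {b : Fin 3 → EuclideanSpace ℂ ιB} {r : Fin 3 → ℝ} (ha : Orthonormal ℂ a)
    (hb : Orthonormal ℂ b) (hr : ∀ j, 0 < r j) (hr1 : ∑ j, r j ^ 2 = 1) (h01 : r 0 = r 1)
    {X : Matrix (Fin 3) (Fin 3) ℂ} {κ v₀ v₁ : ℂ} (hκ : κ * conj κ = 1)
    (hv : v₀ * conj v₀ + v₁ * conj v₁ = 1) (hv₀ : v₀ ≠ 0) (hv₁ : v₁ ≠ 0)
    (hsub : ∀ e : ℂ, ‖e‖ = 1 → ∃ x y z, pencil r X x y z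
      = twist κ v₀ v₁ * diagonal ![(r 1 : ℂ), e * r 1, (r 2 : ℂ)] * (twist 1 v₀ v₁)ᴴ)
    (hsup : ∀ x y z : ℂ, z ≠ 0 → HasMarginals r (pencil r X x y z) → ∃ ζ e : ℂ, ‖ζ‖ = 1 ∧ ‖e‖ = 1 ∧
      pencil r X x y z
        = ζ • (twist κ v₀ v₁ * diagonal ![(r 1 : ℂ), e * r 1, (r 2 : ℂ)] * (twist 1 v₀ v₁)ᴴ)) :
    IsTypeII (targetSet a b r X) := by
  have hG := twist_unitary hκ hv
  have hH := twist_unitary (κ := 1) (by simp) hv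
  have ha' := orthonormal_rotate ha hG
  have hb' := orthonormal_rotate hb (conj_conjTranspose_mul hH)
  have hmarg : ∀ e : ℂ, ‖e‖ = 1 → HasMarginals r
      (twist κ v₀ v₁ * diagonal ![(r 1 : ℂ), e * r 1, (r 2 : ℂ)] * (twist 1 v₀ v₁)ᴴ) := by
    intro e he
    refine HasMarginals.conj_unitary ?_ hG hH (twist_comm_diagonal _ _ _ h01)
      (twist_comm_diagonal _ _ _ h01)
    rw [hasMarginals_diagonal_iff r hr]
    intro j
    fin_cases j
    · simp [(hr 1).le, h01]
    · simp [(hr 1).le, he]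
    · simp [(hr 2).le]
  set a' := rotate a (twist κ v₀ v₁) with ha'_def
  set b' := rotate b (twist 1 v₀ v₁)ᴴᵀ with hb'_def
  set S₁ := rays (circle (ket a' b' (diagonal ![(r 1 : ℂ), 0, (r 2 : ℂ)]))
    (ket a' b' (diagonal ![0, (r 1 : ℂ), 0]))) with hS₁
  have hcomb : ∀ e : ℂ, ket a' b' (diagonal ![(r 1 : ℂ), 0, (r 2 : ℂ)])
      + e • ket a' b' (diagonal ![0, (r 1 : ℂ), 0]) = ket a b
        (twist κ v₀ v₁ * diagonal ![(r 1 : ℂ), e * r 1, (r 2 : ℂ)] * (twist 1 v₀ v₁)ᴴ) := by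
    intro e
    have := smul_ket_diagonal_add a' b' 1 e ![(r 1 : ℂ), 0, (r 2 : ℂ)] ![0, (r 1 : ℂ), 0]
    rw [one_smul] at this
    rw [this, ← ket_rotate]
    congr 2
    ext j
    fin_cases j <;> simp
  have memS₁ : ∀ {Ψ}, Ψ ∈ S₁ ↔ ∃ ζ e : ℂ, ‖ζ‖ = 1 ∧ ‖e‖ = 1 ∧ Ψ = ζ • ket a b
        (twist κ v₀ v₁ * diagonal ![(r 1 : ℂ), e * r 1, (r 2 : ℂ)] * (twist 1 v₀ v₁)ᴴ) := by
    intro Ψ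
    constructor
    · rintro ⟨ζ, hζ, _, ⟨α, rfl⟩, rfl⟩
      exact ⟨ζ, exp (α * I), hζ, norm_exp_ofReal_mul_I α, by rw [hcomb]⟩
    · rintro ⟨ζ, e, hζ, he, rfl⟩
      obtain ⟨α, rfl⟩ := (Complex.norm_eq_one_iff e).mp he
      exact ⟨ζ, hζ, _, ⟨α, rfl⟩, by rw [hcomb]⟩
  refine ⟨baseDisk a b r, S₁, ?_, ?_, ?_, ?_, ?_⟩
  · ext Ψ
    constructor
    · intro h
      rcases (mem_targetSet_iff hr).mp h with h | ⟨x, y, z, hz, hm, rfl⟩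
      · exact Or.inl h
      · obtain ⟨ζ, e, hζ, he, h'⟩ := hsup x y z hz hm
        exact Or.inr (memS₁.mpr ⟨ζ, e, hζ, he, by rw [h', ket_smul]⟩)
    · rintro (h | h)
      · exact (mem_targetSet_iff hr).mpr (Or.inl h)
      · obtain ⟨ζ, e, hζ, he, rfl⟩ := memS₁.mp h
        obtain ⟨x, y, z, h'⟩ := hsub e he
        refine ⟨ζ * x, ζ * y, ζ * z, ?_, ?_⟩
        · rw [pencil_smul, h']
          exact (hmarg e he).smul hζ
        · rw [pencil_smul, h', ket_smul]
  · exact ⟨_, isSchmidtHyperdisk_schmidtHyperdisk ha hb hr hr1,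
      isSubhyperdisk_baseDisk ha hb hr hr1⟩
  · refine ⟨_, isSchmidtHyperdisk_schmidtHyperdisk ha' hb' hr hr1,
      isSubhyperdisk_rays_circle ha' hb' hr hr1 (fun j => ?_) (fun h => ?_) (fun h => ?_)⟩
    · fin_cases j
      · exact Or.inr ⟨by simp [h01, (hr 1).le], rfl⟩
      · exact Or.inl ⟨rfl, by simp [(hr 1).le]⟩
      · exact Or.inr ⟨by simp [(hr 2).le], rfl⟩
    · have := congrFun h 0
      simp [(hr 1).ne'] at this
    · have := congrFun h 1
      simp [(hr 1).ne'] at this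
  -- The point `e = -1` has a nonzero `(0, 1)` entry. The point `e = 1` would not do, since it lies
  -- on the base disk.
  · refine onDifferentSchmidtHyperdisks_baseDisk ha hb hr
      (memS₁.mpr ⟨1, -1, by simp, by simp, (one_smul _ _).symm⟩) (j := 1) (by decide) ?_
    rw [twist_mul_diagonal_mul]
    have hκ0 : κ ≠ 0 := by rintro rfl; simp at hκ
    have : (-1 - 1 : ℂ) ≠ 0 := by norm_num
    simp only [of_apply, cons_val', cons_val_one, cons_val_zero, cons_val_fin_one]
    have hr1' : (r 1 : ℂ) ≠ 0 := ofReal_ne_zero.mpr (hr 1).ne'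
    exact mul_ne_zero (mul_ne_zero (mul_ne_zero (mul_ne_zero hκ0 hr1') hv₀)
      ((map_ne_zero _).mpr hv₁)) this
  · have hκn : ‖κ‖ = 1 := by
      rw [mul_conj'] at hκ
      exact (pow_eq_one_iff_of_nonneg (norm_nonneg _) two_ne_zero).mp (by exact_mod_cast hκ)
    have hvn : ‖v₀‖ ^ 2 + ‖v₁‖ ^ 2 = 1 := by
      simp only [mul_conj'] at hv
      exact_mod_cast hv
    have e1 : conj (κ * v₀) * (κ * v₀) + conj v₁ * v₁ = 1 := by
      simp only [map_mul]
      linear_combination conj v₀ * v₀ * hκ + hv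
    have e2 : conj (κ * conj v₁) * (κ * conj v₁) + conj (-conj v₀) * (-conj v₀) = 1 := by
      simp only [map_mul, map_neg, conj_conj]
      linear_combination conj v₁ * v₁ * hκ + hv
    have e3 : conj (κ * v₀) * (κ * conj v₁) + conj v₁ * (-conj v₀) = 0 := by
      simp only [map_mul]
      linear_combination conj v₁ * conj v₀ * hκ
    have onA := orthonormal_pair ha (i := 0) (j := 1) (by decide) e1 e2 e3
    have onB : Orthonormal ℂ ![conj v₀ • b 0 + conj v₁ • b 1, v₁ • b 0 + (-v₀) • b 1] := by
      refine orthonormal_pair hb (by decide) ?_ ?_ ?_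
      · simp only [conj_conj]
        linear_combination hv
      · simp only [map_neg]
        linear_combination hv
      · simp only [conj_conj]
        ring
    refine ⟨a, b, r 1 ^ 2, r 2 ^ 2, _, _, _, _, ha, hb, pow_pos (hr 1) 2, pow_pos (hr 2) 2, ?_,
      onA, span_pair_eq ha (by decide) onA, onB, span_pair_eq hb (by decide) onB, ?_, ?_, ?_, ?_,
      ?_⟩
    · rw [Fin.sum_univ_three, h01] at hr1
      linarith
    · rw [inner_pair_left ha (by decide), norm_mul, hκn, one_mul]
      exact norm_pos_iff.mpr hv₀
    · rw [inner_pair_left ha (by decide), inner_pair_left hb (by decide), norm_mul, hκn, one_mul]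
      simp
    · rw [inner_pair_left ha (by decide), norm_mul, hκn, one_mul]
      have := norm_pos_iff.mpr hv₁
      nlinarith [norm_nonneg v₀]
    · rw [baseDisk_eq, h01, Real.sqrt_sq (hr 1).le, Real.sqrt_sq (hr 2).le]
    · rw [Real.sqrt_sq (hr 1).le, Real.sqrt_sq (hr 2).le, hS₁]
      congr 1
      ext Ψ
      refine exists_congr fun β => ?_
      rw [ket_diagonal, ket_diagonal, Fin.sum_univ_three, Fin.sum_univ_three, ha'_def, hb'_def,
        rotate_twist, rotate_conj_twist]
      simp only [cons_val_zero, cons_val_one, cons_val, zero_smul, add_zero, zero_add, smul_add,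
        smul_smul, mul_comm]
      rw [add_right_comm]

/-- Up to a phase, an admissible matrix with `z ≠ 0` has `y + z = 1`. Such matrices lie on the line
through `X` and `diag(sκ, s, r₂)`, where `κ` is a suitable phase. The direction of this line has
rank one, so admissibility cuts out a circle, parametrised by the eigenvalue `e` in the twisted
form. -/
theorem targetSet_isTypeII_of_eq {a : Fin 3 → EuclideanSpace ℂ ιA}
    {b : Fin 3 → EuclideanSpace ℂ ιB} {r : Fin 3 → ℝ} (ha : Orthonormal ℂ a)
    (hb : Orthonormal ℂ b) (hr : ∀ j, 0 < r j) (hr1 : ∑ j, r j ^ 2 = 1) (h01 : r 0 = r 1)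
    {X : Matrix (Fin 3) (Fin 3) ℂ} (hX : HasMarginals r X) (h02 : X 0 2 = 0) (h20 : X 2 0 = 0)
    (h12 : X 1 2 = 0) (h21 : X 2 1 = 0) (h22 : X 2 2 = r 2) (hX01 : X 0 1 ≠ 0) :
    IsTypeII (targetSet a b r X) := by
  have r0 := hX.row 0 0
  have r1 := hX.row 1 1
  have r01 := hX.row 0 1
  have c0 := hX.col 0 0
  rw [h02] at r0 r01
  rw [h12] at r1
  rw [h20] at c0
  rw [h01] at r0 c0
  simp only [map_zero, mul_zero, zero_mul, add_zero, if_true, Fin.isValue, zero_ne_one,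
    if_false] at r0 r1 r01 c0
  set s : ℝ := r 1 with hs
  have hs0 : 0 < s := hr 1
  have sc : (s : ℂ) ≠ 0 := ofReal_ne_zero.mpr hs0.ne'
  set W : ℂ := s - conj (X 1 1) with hW
  have hWc : conj W = s - X 1 1 := by rw [hW, map_sub, conj_ofReal, conj_conj]
  have h0110 : X 0 1 * conj (X 0 1) = X 1 0 * conj (X 1 0) := by
    linear_combination r0 - c0
  have h10 : X 1 0 ≠ 0 := by
    intro h
    rw [h, zero_mul, mul_conj'] at h0110
    apply hX01
    simpa using h0110
  have h10c : conj (X 1 0) ≠ 0 := (map_ne_zero _).mpr h10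
  have hW0 : W ≠ 0 := by
    intro h
    apply h10
    have h11 : X 1 1 = s := by
      have := hWc
      rw [h, map_zero] at this
      linear_combination this
    rw [h11, conj_ofReal] at r1
    have : X 1 0 * conj (X 1 0) = 0 := by linear_combination r1
    rcases mul_eq_zero.mp this with h | h
    · exact h
    · exact absurd h h10c
  have hWc0 : conj W ≠ 0 := (map_ne_zero _).mpr hW0
  set ν : ℝ := √(‖X 1 0‖ ^ 2 + ‖W‖ ^ 2) with hν
  have hpos : 0 < ‖X 1 0‖ ^ 2 + ‖W‖ ^ 2 := by
    have := norm_pos_iff.mpr h10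
    positivity
  have hν0 : 0 < ν := Real.sqrt_pos.mpr hpos
  have νc : (ν : ℂ) ≠ 0 := ofReal_ne_zero.mpr hν0.ne'
  have νsq : (ν : ℂ) ^ 2 = X 1 0 * conj (X 1 0) + W * conj W := by
    rw [mul_conj', mul_conj']
    exact_mod_cast Real.sq_sqrt hpos.le
  have νsq' : (ν : ℂ) ^ 2 = s * (W + conj W) := by
    rw [νsq, hWc, hW]
    linear_combination r1
  -- This `κ` makes `X - diag(sκ, s, r₂)` of rank one. It has modulus 1 because `‖X 0 1‖ = ‖X 1 0‖`.
  set κ : ℂ := X 0 1 * W / (conj (X 1 0) * conj W) with hκ_def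
  have hκ : κ * conj κ = 1 := by
    rw [hκ_def, map_div₀, map_mul, map_mul, conj_conj, conj_conj]
    field_simp
    linear_combination h0110
  have h00 : X 0 0 * W = κ * (s * W - X 1 0 * conj (X 1 0)) := by
    have : s * W - X 1 0 * conj (X 1 0) = - conj (X 1 1) * conj W := by
      rw [hWc, hW]; linear_combination -r1
    rw [this, hκ_def]
    field_simp
    linear_combination r01
  have h01κ : X 0 1 * W = κ * conj (X 1 0) * conj W := by
    rw [hκ_def]; field_simp
  have h11 : X 1 1 = s - conj W := by rw [hWc]; ring
  set v₀ : ℂ := -conj (X 1 0) / ν with hv₀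
  set v₁ : ℂ := W / ν with hv₁
  have cv₀ : conj v₀ = -X 1 0 / ν := by
    rw [hv₀, map_div₀, map_neg, conj_conj, conj_ofReal]
  have cv₁ : conj v₁ = conj W / ν := by
    rw [hv₁, map_div₀, conj_ofReal]
  have hv : v₀ * conj v₀ + v₁ * conj v₁ = 1 := by
    rw [cv₀, cv₁, hv₀, hv₁]
    field_simp
    linear_combination -νsq
  have hpencil : ∀ e z : ℂ, z * (ν : ℂ) ^ 2 = (1 - e) * s * W →
      pencil r X (s * κ * (1 - z)) (1 - z) z
        = twist κ v₀ v₁ * diagonal ![(s : ℂ), e * s, (r 2 : ℂ)] * (twist 1 v₀ v₁)ᴴ := by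
    intro e z hz
    have hz' : z = (1 - e) * s * W / (ν : ℂ) ^ 2 := by
      rw [eq_div_iff (pow_ne_zero 2 νc), hz]
    rw [pencil_eq, twist_mul_diagonal_mul, h02, h20, h12, h21, h22, cv₀, cv₁, ← hs]
    ext i j
    fin_cases i <;> fin_cases j <;>
      simp only [Fin.zero_eta, Fin.mk_one, Fin.reduceFinMk, of_apply, cons_val', cons_val_zero,
        cons_val_one, cons_val, cons_val_fin_one, mul_zero]
    · have h00' : z * X 0 0 = κ * (z * s - (1 - e) * s * (X 1 0 * conj (X 1 0)) / (ν : ℂ) ^ 2) := by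
        apply mul_right_cancel₀ hW0
        rw [mul_assoc, h00, hz']
        field_simp
      rw [h00', hv₀, hv₁]
      field_simp
      linear_combination κ * νsq
    · have h01' : z * X 0 1 = (1 - e) * s * (κ * conj (X 1 0) * conj W) / (ν : ℂ) ^ 2 := by
        rw [← h01κ, hz']
        field_simp
      rw [h01', hv₀]
      field_simp
      ring
    · rw [hz', hv₁]
      field_simp
      ring
    · rw [hz', hv₀, hv₁, h11]
      field_simp
      linear_combination νsq
    · ring
  refine targetSet_isTypeII_of_twist ha hb hr hr1 h01 hκ hv
    (div_ne_zero (neg_ne_zero.mpr h10c) νc) (div_ne_zero hW0 νc) ?_ ?_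
  · intro e he
    exact ⟨_, _, _, hpencil e ((1 - e) * s * W / (ν : ℂ) ^ 2) (by field_simp)⟩
  · intro x y z hz h
    -- Row 2 of the pencil is `(0, 0, (y + z) r₂)`, so `y + z` is a phase; it is divided out below.
    have hζ : ‖y + z‖ = 1 := by
      have rn := h.row_norm 2
      rw [pencil_eq] at rn
      simp only [of_apply, cons_val', cons_val_zero, cons_val_one, cons_val, cons_val_fin_one,
        h20, h21, h22, mul_zero, norm_zero, ← add_mul, norm_mul, norm_real,
        Real.norm_of_nonneg (hr 2).le] at rn
      have : ‖y + z‖ ^ 2 = 1 := by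
        have := pow_pos (hr 2) 2
        apply mul_right_cancel₀ this.ne'
        linear_combination rn
      exact (pow_eq_one_iff_of_nonneg (norm_nonneg _) two_ne_zero).mp this
    have hζ0 : y + z ≠ 0 := by
      intro h0
      rw [h0, norm_zero] at hζ
      exact zero_ne_one hζ
    obtain ⟨x', rfl⟩ : ∃ x', x = (y + z) * x' := ⟨x / (y + z), by field_simp⟩
    obtain ⟨z', hz'⟩ : ∃ z', z = (y + z) * z' := ⟨z / (y + z), by field_simp⟩
    have hy' : y = (y + z) * (1 - z') := by linear_combination -hz'
    have hp : pencil r X ((y + z) * x') y z = (y + z) • pencil r X x' (1 - z') z' := by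
      rw [← pencil_smul, ← hy', ← hz']
    have hz0 : z' ≠ 0 := by
      rintro rfl
      exact hz (by rw [hz', mul_zero])
    have hzc0 : conj z' ≠ 0 := (map_ne_zero _).mpr hz0
    have hm : HasMarginals r (pencil r X x' (1 - z') z') := by
      have := h.smul (c := (y + z)⁻¹) (by rw [norm_inv, hζ, inv_one])
      rwa [hp, smul_smul, inv_mul_cancel₀ hζ0, one_smul] at this
    have k1 := hm.row 1 1
    have k01 := hm.row 0 1
    rw [pencil_eq] at k1 k01
    simp [h02, h12, ← hs] at k1 k01
    -- The norm of row 1 puts `z'` on the circle `|1 - z' ν² / (sW)| = 1`. Together with the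
    -- orthogonality of rows 0 and 1 this determines `x'`.
    have hR : s * (z' * conj W + conj z' * W) = z' * conj z' * (ν : ℂ) ^ 2 := by
      rw [νsq, hWc, hW]
      linear_combination -k1
    have hx' : x' = s * κ * (1 - z') := by
      have hk : x' * (conj z' * conj (X 1 0)) = -(z' * X 0 1 * s * (1 - conj z')) := by
        linear_combination k01 - z' * conj z' * r01
      have hR' : z' * conj W + conj z' * W = z' * conj z' * (W + conj W) := by
        apply mul_left_cancel₀ sc
        rw [hR, νsq']
        ring
      rw [hκ_def]
      field_simp
      apply mul_left_cancel₀ hzc0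
      linear_combination conj W * hk - s * X 0 1 * hR'
    set e : ℂ := 1 - z' * (ν : ℂ) ^ 2 / (s * W) with he_def
    have he : ‖e‖ = 1 := by
      have : e * conj e = 1 := by
        rw [he_def]
        simp only [map_sub, map_one, map_div₀, map_mul, map_pow, conj_ofReal]
        field_simp
        linear_combination -(ν : ℂ) ^ 2 * hR
      rw [mul_conj'] at this
      exact (pow_eq_one_iff_of_nonneg (norm_nonneg _) two_ne_zero).mp (by exact_mod_cast this)
    refine ⟨y + z, e, hζ, he, ?_⟩
    rw [hp, hx', hpencil e z' (by rw [he_def]; field_simp; ring)]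

/-- The entry `X 2 2` stands alone in its row and so has modulus `r 2`. A global phase makes it
equal to `r 2`, and `X 0 1 ≠ 0` forces `r 0 = r 1`. -/
theorem targetSet_isTypeII {a : Fin 3 → EuclideanSpace ℂ ιA}
    {b : Fin 3 → EuclideanSpace ℂ ιB} {r : Fin 3 → ℝ} (ha : Orthonormal ℂ a)
    (hb : Orthonormal ℂ b) (hr : ∀ j, 0 < r j) (hr1 : ∑ j, r j ^ 2 = 1)
    {X : Matrix (Fin 3) (Fin 3) ℂ} (hX : HasMarginals r X) (h02 : X 0 2 = 0) (h20 : X 2 0 = 0)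
    (h12 : X 1 2 = 0) (h21 : X 2 1 = 0) (hX01 : X 0 1 ≠ 0) :
    IsTypeII (targetSet a b r X) := by
  have h01 : r 0 = r 1 := by
    by_contra h
    exact hX01 (hX.apply_eq_zero hr h)
  have hn : ‖X 2 2‖ = r 2 := by
    have := hX.row_norm 2
    rw [h20, h21, norm_zero] at this
    rw [← pow_left_inj₀ (norm_nonneg _) (hr 2).le two_ne_zero]
    linarith
  have hc : ‖exp ((-arg (X 2 2) : ℝ) * I)‖ = 1 := norm_exp_ofReal_mul_I _
  rw [← targetSet_smul a b r X (exp_ne_zero ((-arg (X 2 2) : ℝ) * I))]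
  refine targetSet_isTypeII_of_eq ha hb hr hr1 h01 (hX.smul hc) (by simp [h02]) (by simp [h20])
    (by simp [h12]) (by simp [h21]) ?_ ?_
  · rw [Matrix.smul_apply, smul_eq_mul, ← hn]
    nth_rewrite 2 [← norm_mul_exp_arg_mul_I (X 2 2)]
    rw [mul_left_comm, ← exp_add]
    simp
  · rw [Matrix.smul_apply, smul_eq_mul]
    exact mul_ne_zero (exp_ne_zero _) hX01

/-! ### Changes of basis and the trichotomy. -/

/-- The rotation of the last two coordinates with first column `(v₁, v₂)`. -/
def blockRotation (v₁ v₂ : ℂ) : Matrix (Fin 3) (Fin 3) ℂ :=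
  !![1, 0, 0; 0, v₁, -conj v₂; 0, v₂, conj v₁]

theorem blockRotation_unitary {v₁ v₂ : ℂ} (hv : v₁ * conj v₁ + v₂ * conj v₂ = 1) :
    (blockRotation v₁ v₂)ᴴ * blockRotation v₁ v₂ = 1 := by
  ext i j
  fin_cases i <;> fin_cases j <;>
    simp [blockRotation, mul_apply, Fin.sum_univ_three]
  · linear_combination hv
  · ring
  · ring
  · linear_combination hv

theorem blockRotation_comm_diagonal (v₁ v₂ : ℂ) {d : Fin 3 → ℂ} (h : d 1 = d 2) :
    blockRotation v₁ v₂ * diagonal d = diagonal d * blockRotation v₁ v₂ := by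
  ext i j
  rw [mul_diagonal, diagonal_mul]
  fin_cases i <;> fin_cases j <;> simp [blockRotation, h, mul_comm]

/-- Rotating the last two vectors of both local bases when `r₁ = r₂`. -/
theorem exists_rotated_targetSet {a : Fin 3 → EuclideanSpace ℂ ιA}
    {b : Fin 3 → EuclideanSpace ℂ ιB} {r : Fin 3 → ℝ} (ha : Orthonormal ℂ a)
    (hb : Orthonormal ℂ b) (h12 : r 1 = r 2) {X : Matrix (Fin 3) (Fin 3) ℂ}
    (hX : HasMarginals r X) {v₁ v₂ : ℂ} (hv : v₁ * conj v₁ + v₂ * conj v₂ = 1) :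
    ∃ (a' : Fin 3 → EuclideanSpace ℂ ιA) (b' : Fin 3 → EuclideanSpace ℂ ιB),
      Orthonormal ℂ a' ∧ Orthonormal ℂ b' ∧
      HasMarginals r ((blockRotation v₁ v₂)ᴴ * X * blockRotation v₁ v₂) ∧
      targetSet a b r X
        = targetSet a' b' r ((blockRotation v₁ v₂)ᴴ * X * blockRotation v₁ v₂) := by
  have hG := blockRotation_unitary hv
  have hG' := mul_eq_one_comm.mp hG
  have hr : blockRotation v₁ v₂ * diagonal (fun j => (r j : ℂ) ^ 2)
      = diagonal (fun j => (r j : ℂ) ^ 2) * blockRotation v₁ v₂ :=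
    blockRotation_comm_diagonal v₁ v₂ (by simp [h12])
  have hGH : ((blockRotation v₁ v₂)ᴴ)ᴴ * (blockRotation v₁ v₂)ᴴ = 1 := by
    rw [conjTranspose_conjTranspose, hG']
  have hGHr : (blockRotation v₁ v₂)ᴴ * diagonal (fun j => (r j : ℂ) ^ 2)
      = diagonal (fun j => (r j : ℂ) ^ 2) * (blockRotation v₁ v₂)ᴴ := by
    have := congrArg conjTranspose hr
    have hstar : star (fun j => (r j : ℂ) ^ 2) = fun j => (r j : ℂ) ^ 2 := by
      ext j; simp
    rw [conjTranspose_mul, conjTranspose_mul, diagonal_conjTranspose, hstar] at this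
    exact this.symm
  refine ⟨_, _, orthonormal_rotate ha hG, orthonormal_rotate hb (conj_conjTranspose_mul hG), ?_,
    targetSet_rotate a b r X hG hr (blockRotation_comm_diagonal v₁ v₂ (by simp))
      (blockRotation_comm_diagonal v₁ v₂ (by simp [h12]))⟩
  have := hX.conj_unitary hGH hGH hGHr hGHr
  rwa [conjTranspose_conjTranspose] at this

theorem hasMarginals_submatrix (r : Fin 3 → ℝ) (m : Matrix (Fin 3) (Fin 3) ℂ)
    (σ : Equiv.Perm (Fin 3)) :
    HasMarginals (r ∘ σ) (m.submatrix σ σ) ↔ HasMarginals r m := by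
  have hd : diagonal (fun j => (((r ∘ σ) j : ℝ) : ℂ) ^ 2)
      = (diagonal fun j => (r j : ℂ) ^ 2).submatrix σ σ := by
    rw [submatrix_diagonal_equiv]
    rfl
  have hinj : ∀ A B : Matrix (Fin 3) (Fin 3) ℂ, A.submatrix σ σ = B.submatrix σ σ ↔ A = B :=
    fun A B => (reindex σ.symm σ.symm).injective.eq_iff
  simp only [HasMarginals, hd, conjTranspose_submatrix, submatrix_mul_equiv, hinj]

/-- Exchanging the labels 1 and 2 preserves `|00⟩` and `r₁|11⟩ + r₂|22⟩`, so the two ways of mixing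
index 0 with one other index need only one treatment. -/
theorem targetSet_swap (a : Fin 3 → EuclideanSpace ℂ ιA) (b : Fin 3 → EuclideanSpace ℂ ιB)
    (r : Fin 3 → ℝ) (X : Matrix (Fin 3) (Fin 3) ℂ) (σ : Equiv.Perm (Fin 3))
    (hσ : σ = Equiv.swap 1 2) :
    targetSet a b r X = targetSet (a ∘ σ) (b ∘ σ) (r ∘ σ) (X.submatrix σ σ) := by
  have h0 : σ 0 = 0 := by subst hσ; decide
  have h1 : σ 1 = 2 := by subst hσ; decide
  have h2 : σ 2 = 1 := by subst hσ; decide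
  have hp : ∀ x y z, pencil (r ∘ σ) (X.submatrix σ σ) x y z = (pencil r X x y z).submatrix σ σ := by
    intro x y z
    rw [pencil_eq, pencil_eq]
    ext i j
    fin_cases i <;> fin_cases j <;> simp [h0, h1, h2]
  have hk : ∀ m, ket (a ∘ σ) (b ∘ σ) (m.submatrix σ σ) = ket a b m := by
    intro m
    simp only [ket, submatrix_apply, Function.comp_apply]
    rw [Equiv.sum_comp σ (fun i => ∑ j, m i (σ j) • prodKet (a i) (b (σ j)))]
    exact Finset.sum_congr rfl fun i _ => Equiv.sum_comp σ (fun j => m i j • prodKet (a i) (b j))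
  ext Ψ
  simp only [targetSet, Set.mem_ofPred_eq, hp, hasMarginals_submatrix, hk]

/-- The eigenvector serves as a column of `blockRotation` and makes the lower block of `X` upper
triangular. -/
theorem exists_unit_eigenvector (p q s t : ℂ) :
    ∃ l v₁ v₂ : ℂ, v₁ * conj v₁ + v₂ * conj v₂ = 1 ∧ p * v₁ + q * v₂ = l * v₁ ∧
      s * v₁ + t * v₂ = l * v₂ := by
  obtain ⟨l, hl⟩ := Module.End.exists_eigenvalue (toLin' !![p, q; s, t])
  obtain ⟨v, hv⟩ := hl.exists_hasEigenvector
  have h := hv.apply_eq_smul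
  rw [toLin'_apply] at h
  have e0 := congrFun h 0
  have e1 := congrFun h 1
  simp [mulVec, dotProduct, Fin.sum_univ_two] at e0 e1
  have hpos : 0 < ‖v 0‖ ^ 2 + ‖v 1‖ ^ 2 := by
    by_contra hn
    have h0 : ‖v 0‖ ^ 2 = 0 := le_antisymm (by nlinarith [sq_nonneg ‖v 1‖]) (sq_nonneg _)
    have h1 : ‖v 1‖ ^ 2 = 0 := le_antisymm (by nlinarith [sq_nonneg ‖v 0‖]) (sq_nonneg _)
    apply hv.2
    ext j
    fin_cases j
    · simpa using h0
    · simpa using h1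
  set ν : ℝ := √(‖v 0‖ ^ 2 + ‖v 1‖ ^ 2) with hν
  have νc : (ν : ℂ) ≠ 0 := ofReal_ne_zero.mpr (Real.sqrt_pos.mpr hpos).ne'
  have νsq : (ν : ℂ) ^ 2 = v 0 * conj (v 0) + v 1 * conj (v 1) := by
    rw [mul_conj', mul_conj']
    exact_mod_cast Real.sq_sqrt hpos.le
  refine ⟨l, v 0 / ν, v 1 / ν, ?_, ?_, ?_⟩
  · rw [map_div₀, map_div₀, conj_ofReal]
    field_simp
    linear_combination -νsq
  · field_simp
    linear_combination e0
  · field_simp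
    linear_combination e1

theorem blockRotation_conj_apply (v₁ v₂ : ℂ) (X : Matrix (Fin 3) (Fin 3) ℂ) (i j : Fin 3) :
    ((blockRotation v₁ v₂)ᴴ * X * blockRotation v₁ v₂) i j
      = ∑ l, (∑ k, conj (blockRotation v₁ v₂ k i) * X k l) * blockRotation v₁ v₂ l j := by
  simp [mul_apply]

/-- The trichotomy for the target set spanned by `|00⟩`, `r₁|11⟩ + r₂|22⟩` and a further state. -/
theorem targetSet_classification {a : Fin 3 → EuclideanSpace ℂ ιA}
    {b : Fin 3 → EuclideanSpace ℂ ιB} {r : Fin 3 → ℝ} (ha : Orthonormal ℂ a)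
    (hb : Orthonormal ℂ b) (hr : ∀ j, 0 < r j) (hr1 : ∑ j, r j ^ 2 = 1)
    {X : Matrix (Fin 3) (Fin 3) ℂ} (hX : HasMarginals r X) (hni : ∀ x y, X ≠ pencil r X x y 0) :
    IsTypeI (targetSet a b r X) ∨ IsTypeII (targetSet a b r X) ∨ IsTypeIII (targetSet a b r X) := by
  have row0 := hX.row_norm 0
  have col0 := hX.col_norm 0
  have hr1c : (r 1 : ℂ) ≠ 0 := ofReal_ne_zero.mpr (hr 1).ne'
  by_cases hA : X 0 1 = 0 ∧ X 0 2 = 0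
  · left
    obtain ⟨h01, h02⟩ := hA
    rw [h01, h02, norm_zero] at row0
    -- Row 0 and column 0 have the same norm `r 0`, so column 0 vanishes off the diagonal as well.
    have h10 : X 1 0 = 0 := by
      have : ‖X 1 0‖ ^ 2 = 0 :=
        le_antisymm (by nlinarith [sq_nonneg ‖X 2 0‖]) (sq_nonneg _)
      simpa using this
    have h20 : X 2 0 = 0 := by
      have : ‖X 2 0‖ ^ 2 = 0 :=
        le_antisymm (by nlinarith [sq_nonneg ‖X 1 0‖]) (sq_nonneg _)
      simpa using this
    by_cases hB : X 1 2 = 0 ∧ X 2 1 = 0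
    · obtain ⟨h12, h21⟩ := hB
      have hd : X = diagonal ![X 0 0, X 1 1, X 2 2] := by
        ext i j
        fin_cases i <;> fin_cases j <;> simp [h01, h02, h10, h20, h12, h21]
      rw [hd]
      refine targetSet_diagonal_isTypeI ha hb hr hr1 fun h => ?_
      refine hni (X 0 0) (X 1 1 / r 1) ?_
      rw [pencil_zero]
      nth_rewrite 1 [hd]
      congr 1
      ext j
      fin_cases j
      · rfl
      · simp [hr1c]
      · simp at h ⊢
        field_simp
        linear_combination -h
    · have h12 : r 1 = r 2 := by
        by_contra h
        exact hB ⟨hX.apply_eq_zero hr h, hX.apply_eq_zero hr (Ne.symm h)⟩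
      obtain ⟨l, v₁, v₂, hv, he1, he2⟩ :=
        exists_unit_eigenvector (X 1 1) (X 1 2) (X 2 1) (X 2 2)
      obtain ⟨a', b', ha', hb', hX', hT⟩ := exists_rotated_targetSet ha hb h12 hX hv
      set Y := (blockRotation v₁ v₂)ᴴ * X * blockRotation v₁ v₂ with hY
      have hYX : X = blockRotation v₁ v₂ * Y * (blockRotation v₁ v₂)ᴴ := by
        have hG' := mul_eq_one_comm.mp (blockRotation_unitary hv)
        rw [hY]
        calc X = (blockRotation v₁ v₂ * (blockRotation v₁ v₂)ᴴ) * X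
              * (blockRotation v₁ v₂ * (blockRotation v₁ v₂)ᴴ) := by
              rw [hG', Matrix.one_mul, Matrix.mul_one]
          _ = _ := by simp only [Matrix.mul_assoc]
      have y01 : Y 0 1 = 0 := by
        rw [hY, blockRotation_conj_apply]
        simp [blockRotation, Fin.sum_univ_three, h01, h02]
      have y02 : Y 0 2 = 0 := by
        rw [hY, blockRotation_conj_apply]
        simp [blockRotation, Fin.sum_univ_three, h01, h02]
      have y10 : Y 1 0 = 0 := by
        rw [hY, blockRotation_conj_apply]
        simp [blockRotation, Fin.sum_univ_three, h10, h20]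
      have y20 : Y 2 0 = 0 := by
        rw [hY, blockRotation_conj_apply]
        simp [blockRotation, Fin.sum_univ_three, h10, h20]
      have y21 : Y 2 1 = 0 := by
        rw [hY, blockRotation_conj_apply]
        simp [blockRotation, Fin.sum_univ_three]
        linear_combination -v₂ * he1 + v₁ * he2
      -- The block is triangular, and row 1 and column 1 have equal norms, so it is diagonal.
      have y12 : Y 1 2 = 0 := by
        have h1 := hX'.row_norm 1
        have h2 := hX'.col_norm 1
        rw [y10, norm_zero] at h1
        rw [y01, y21, norm_zero] at h2
        have : ‖Y 1 2‖ ^ 2 = 0 := by linarith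
        simpa using this
      have hd : Y = diagonal ![Y 0 0, Y 1 1, Y 2 2] := by
        ext i j
        fin_cases i <;> fin_cases j <;> simp [y01, y02, y10, y20, y12, y21]
      rw [hT, hd]
      refine targetSet_diagonal_isTypeI ha' hb' hr hr1 fun h => ?_
      refine hni (Y 0 0) (Y 1 1 / r 1) ?_
      have h' : Y 1 1 = Y 2 2 := by
        simp [h12] at h
        rcases h with h | h
        · exact h
        · exact absurd h (hr 2).ne'
      -- If the last two entries of `Y` agreed, `Y` would commute with the rotation and `X = Y`
      -- would lie in the span of the first two generators.
      rw [hYX, hd, blockRotation_comm_diagonal _ _ (by simpa using h'), Matrix.mul_assoc,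
        mul_eq_one_comm.mp (blockRotation_unitary hv), Matrix.mul_one, pencil_zero]
      congr 1
      have hr2c : (r 2 : ℂ) ≠ 0 := ofReal_ne_zero.mpr (hr 2).ne'
      ext j
      fin_cases j
      · simp
      · simp [h12, hr2c]
      · simp [h12, hr2c, h']
  · right
    by_cases h01 : r 0 = r 1
    swap
    · have x01 := hX.apply_eq_zero hr h01
      have x10 := hX.apply_eq_zero hr (Ne.symm h01)
      have x02 : X 0 2 ≠ 0 := fun h => hA ⟨x01, h⟩
      have h02 : r 0 = r 2 := by
        by_contra h
        exact x02 (hX.apply_eq_zero hr h)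
      have h12 : r 1 ≠ r 2 := fun h => h01 (h02.trans h.symm)
      left
      rw [targetSet_swap a b r X _ rfl]
      have s0 : Equiv.swap (1 : Fin 3) 2 0 = 0 := by decide
      have s1 : Equiv.swap (1 : Fin 3) 2 1 = 2 := by decide
      have s2 : Equiv.swap (1 : Fin 3) 2 2 = 1 := by decide
      refine targetSet_isTypeII (ha.comp _ (Equiv.injective _)) (hb.comp _ (Equiv.injective _))
        (fun j => hr _) ?_ ?_ ?_ ?_ ?_ ?_ ?_
      · rw [← hr1]
        exact Equiv.sum_comp (Equiv.swap (1 : Fin 3) 2) (fun j => r j ^ 2)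
      · exact (hasMarginals_submatrix r X _).mpr hX
      · rw [submatrix_apply, s0, s2, x01]
      · rw [submatrix_apply, s0, s2, x10]
      · rw [submatrix_apply, s1, s2]
        exact hX.apply_eq_zero hr (Ne.symm h12)
      · rw [submatrix_apply, s1, s2]
        exact hX.apply_eq_zero hr h12
      · rwa [submatrix_apply, s0, s1]
    by_cases h02 : r 0 = r 2
    swap
    · have x02 := hX.apply_eq_zero hr h02
      have h12 : r 1 ≠ r 2 := fun h => h02 (h01.trans h)
      exact Or.inl (targetSet_isTypeII ha hb hr hr1 hX x02 (hX.apply_eq_zero hr (Ne.symm h02))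
        (hX.apply_eq_zero hr h12) (hX.apply_eq_zero hr (Ne.symm h12)) fun h => hA ⟨h, x02⟩)
    have hlt : ‖X 0 0‖ ^ 2 < r 0 ^ 2 := by
      by_contra hge
      apply hA
      have e1 : ‖X 0 1‖ ^ 2 = 0 :=
        le_antisymm (by nlinarith [sq_nonneg ‖X 0 2‖]) (sq_nonneg _)
      have e2 : ‖X 0 2‖ ^ 2 = 0 :=
        le_antisymm (by nlinarith [sq_nonneg ‖X 0 1‖]) (sq_nonneg _)
      exact ⟨by simpa using e1, by simpa using e2⟩
    have hr3 : ∀ j, r j = (√3)⁻¹ := by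
      have h0 : r 0 = (√3)⁻¹ := by
        rw [Fin.sum_univ_three, ← h01, ← h02] at hr1
        rw [← pow_left_inj₀ (hr 0).le (by positivity) two_ne_zero, inv_pow,
          Real.sq_sqrt (by norm_num)]
        linarith
      intro j
      fin_cases j
      · exact h0
      · exact h01.symm.trans h0
      · exact h02.symm.trans h0
    have hpos : 0 < ‖X 1 0‖ ^ 2 + ‖X 2 0‖ ^ 2 := by linarith
    -- All `r j` are equal here, so the indices 1 and 2 may be rotated. The new index 1 is aligned
    -- with `(X 1 0, X 2 0)`, which makes `Y 2 0` vanish.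
    set ν : ℝ := √(‖X 1 0‖ ^ 2 + ‖X 2 0‖ ^ 2) with hν
    have νc : (ν : ℂ) ≠ 0 := ofReal_ne_zero.mpr (Real.sqrt_pos.mpr hpos).ne'
    have νsq : (ν : ℂ) ^ 2 = X 1 0 * conj (X 1 0) + X 2 0 * conj (X 2 0) := by
      rw [mul_conj', mul_conj']
      exact_mod_cast Real.sq_sqrt hpos.le
    have hv : X 1 0 / ν * conj (X 1 0 / ν) + X 2 0 / ν * conj (X 2 0 / ν) = 1 := by
      rw [map_div₀, map_div₀, conj_ofReal]
      field_simp
      linear_combination -νsq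
    obtain ⟨a', b', ha', hb', hX', hT⟩ :=
      exists_rotated_targetSet ha hb (h01.symm.trans h02) hX hv
    set Y := (blockRotation (X 1 0 / ν) (X 2 0 / ν))ᴴ * X * blockRotation (X 1 0 / ν) (X 2 0 / ν)
      with hY
    have y00 : Y 0 0 = X 0 0 := by
      rw [hY, blockRotation_conj_apply]
      simp [blockRotation, Fin.sum_univ_three]
    have y20 : Y 2 0 = 0 := by
      rw [hY, blockRotation_conj_apply]
      simp [blockRotation, Fin.sum_univ_three]
      ring
    rw [hT]
    -- If `Y 0 2 = 0`, orthogonality of columns 0 and 2 and of rows 0 and 2 removes `Y 1 2` and `Y 2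
    -- 1`, so index 2 decouples.
    by_cases y02 : Y 0 2 = 0
    · left
      have rn := hX'.row_norm 0
      have cn := hX'.col_norm 0
      rw [y00, y02, norm_zero] at rn
      rw [y00, y20, norm_zero] at cn
      have y01 : Y 0 1 ≠ 0 := by
        intro h
        rw [h, norm_zero] at rn
        linarith
      have y10 : Y 1 0 ≠ 0 := by
        intro h
        rw [h, norm_zero] at cn
        linarith
      have c02 := hX'.col 0 2
      have r02 := hX'.row 0 2
      simp [y02, y20] at c02 r02
      exact targetSet_isTypeII ha' hb' hr hr1 hX' y02 y20 (c02.resolve_left y10)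
        (r02.resolve_left y01) y01
    · exact Or.inr (targetSet_isTypeIII ha' hb' hr3 hX' y20 y02)

/-! ### The standard form of a two-dimensional subhyperdisk. -/

/-- A hyperdisk is nonempty because its span contains the basis. One of its unit vectors shows `r₀²
+ r₁² = 1`, so the vectors `r₀ B₀ + e r₁ B₁` are unit vectors with the prescribed moduli and must
belong to `S`. -/
theorem IsHyperdisk.exists_circle_subset {E : Type*} [NormedAddCommGroup E]
    [InnerProductSpace ℂ E] {S : Set E} (hS : IsHyperdisk 2 S) :
    ∃ u v : E, u ≠ 0 ∧ v ≠ 0 ∧ ∀ e : ℂ, ‖e‖ = 1 → u + e • v ∈ S := by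
  obtain ⟨hnorm, B, r, hB, hspan, hr, hmem, hmax⟩ := hS
  have hite := orthonormal_iff_ite.mp hB
  have norm_comb : ∀ x y : ℂ, ‖x • B 0 + y • B 1‖ ^ 2 = ‖x‖ ^ 2 + ‖y‖ ^ 2 := by
    intro x y
    have := norm_add_sq_eq_norm_sq_add_norm_sq_of_inner_eq_zero (x • B 0) (y • B 1)
      (by rw [inner_smul_left, inner_smul_right, hite]; simp)
    rw [← pow_two, ← pow_two, ← pow_two] at this
    rw [this, norm_smul, norm_smul, hB.1, hB.1, mul_one, mul_one]
  have coeff_comb : ∀ x y : ℂ, coeffVector B (x • B 0 + y • B 1) = ![‖x‖, ‖y‖] := by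
    intro x y
    ext j
    fin_cases j
    · simp only [coeffVector, inner_add_right, inner_smul_right, hite]
      simp
    · simp only [coeffVector, inner_add_right, inner_smul_right, hite]
      simp
  have hne : S.Nonempty := by
    by_contra h
    rw [Set.not_nonempty_iff_eq_empty] at h
    rw [h, Submodule.span_empty] at hspan
    have : B 0 ∈ (⊥ : Submodule ℂ E) := hspan ▸ Submodule.subset_span ⟨0, rfl⟩
    exact hB.ne_zero 0 ((Submodule.mem_bot ℂ).mp this)
  obtain ⟨ψ, hψ⟩ := hne
  have hψspan : ψ ∈ Submodule.span ℂ (Set.range B) := hspan ▸ Submodule.subset_span hψ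
  have hBr : Set.range B = {B 0, B 1} := by
    ext x
    simp [Fin.exists_fin_two, eq_comm]
  rw [hBr, Submodule.mem_span_pair] at hψspan
  obtain ⟨x, y, rfl⟩ := hψspan
  have h1 := hmem _ hψ
  rw [coeff_comb] at h1
  have hrsq : r 0 ^ 2 + r 1 ^ 2 = 1 := by
    have := norm_comb x y
    rw [hnorm _ hψ] at this
    rw [← h1]
    simpa using this.symm
  have hr0 : (r 0 : ℂ) ≠ 0 := ofReal_ne_zero.mpr (hr 0).ne'
  have hr1 : (r 1 : ℂ) ≠ 0 := ofReal_ne_zero.mpr (hr 1).ne'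
  refine ⟨(r 0 : ℂ) • B 0, (r 1 : ℂ) • B 1, smul_ne_zero hr0 (hB.ne_zero 0),
    smul_ne_zero hr1 (hB.ne_zero 1), fun e he => ?_⟩
  rw [smul_smul]
  by_contra hn
  refine hmax _ ?_ hn ?_
  · have := norm_comb (r 0) (e * r 1)
    rw [norm_mul, he, one_mul, norm_real, norm_real, Real.norm_of_nonneg (hr 0).le,
      Real.norm_of_nonneg (hr 1).le, hrsq] at this
    exact (pow_eq_one_iff_of_nonneg (norm_nonneg _) two_ne_zero).mp this
  · rw [coeff_comb]
    ext j
    fin_cases j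
    · simp [(hr 0).le]
    · simp [he, (hr 1).le]

/-- If `|u + e v|` takes the same value for `e = 1, -1, i`, then `u` or `v` vanishes. -/
theorem mul_eq_zero_of_norm_add_eq {u v : ℂ} {ρ : ℝ} (h1 : ‖u + v‖ ^ 2 = ρ)
    (h2 : ‖u - v‖ ^ 2 = ρ) (h3 : ‖u + I * v‖ ^ 2 = ρ) : u = 0 ∨ v = 0 := by
  rw [← normSq_eq_norm_sq, normSq_apply] at h1 h2 h3
  simp at h1 h2 h3
  -- The real and imaginary parts of `u * conj v` vanish by polarisation.
  have e1 : u.re * v.re + u.im * v.im = 0 := by linarith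
  have e2 : u.im * v.re - u.re * v.im = 0 := by linarith
  have : normSq u * normSq v = 0 := by
    rw [normSq_apply, normSq_apply]
    linear_combination (u.re * v.re + u.im * v.im) * e1 + (u.im * v.re - u.re * v.im) * e2
  rcases mul_eq_zero.mp this with h | h
  · exact Or.inl (normSq_eq_zero.mp h)
  · exact Or.inr (normSq_eq_zero.mp h)

theorem orthonormal_phase_comp {E : Type*} [NormedAddCommGroup E] [InnerProductSpace ℂ E]
    {a : Fin 3 → E} (ha : Orthonormal ℂ a) (σ : Equiv.Perm (Fin 3)) {c : Fin 3 → ℂ}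
    (hc : ∀ j, ‖c j‖ = 1) : Orthonormal ℂ (fun j => c j • a (σ j)) := by
  refine ⟨fun j => ?_, fun i j hij => ?_⟩
  · rw [norm_smul, hc, one_mul, ha.1]
  · change inner ℂ (c i • a (σ i)) (c j • a (σ j)) = 0
    rw [inner_smul_left, inner_smul_right, ha.2 fun h => hij (σ.injective h)]
    simp

/-- Two groups of Schmidt terms, one of which is a single term, in adapted local bases. -/
theorem exists_adapted_bases {a : Fin 3 → EuclideanSpace ℂ ιA}
    {b : Fin 3 → EuclideanSpace ℂ ιB} (ha : Orthonormal ℂ a) (hb : Orthonormal ℂ b)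
    (U V : Fin 3 → ℂ) (hn : ∀ j, U j + V j ≠ 0) (h1 : ∑ j, ‖U j + V j‖ ^ 2 = 1)
    (σ : Equiv.Perm (Fin 3)) (hV : V (σ 0) = 0) (hU1 : U (σ 1) = 0) (hU2 : U (σ 2) = 0) :
    ∃ (a' : Fin 3 → EuclideanSpace ℂ ιA) (b' : Fin 3 → EuclideanSpace ℂ ιB) (r : Fin 3 → ℝ),
      Orthonormal ℂ a' ∧ Orthonormal ℂ b' ∧ (∀ j, 0 < r j) ∧ ∑ j, r j ^ 2 = 1 ∧
      ket a' b' (diagonal ![(r 0 : ℂ), r 1, r 2]) = ket a b (diagonal (U + V)) ∧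
      ket a' b' (diagonal ![(r 0 : ℂ), -r 1, -r 2]) = ket a b (diagonal (U - V)) := by
  set d : Fin 3 → ℂ := fun j => U (σ j) + V (σ j) with hd
  have hd0 : ∀ j, (‖d j‖ : ℂ) ≠ 0 := fun j =>
    ofReal_ne_zero.mpr (norm_ne_zero_iff.mpr (hn (σ j)))
  -- The phases of the coefficients `U + V` are absorbed into the first local basis.
  have key : ∀ e : Fin 3 → ℂ,
      ket (fun j => (d j / ‖d j‖) • a (σ j)) (b ∘ σ) (diagonal fun j => e (σ j) * ‖d j‖)
        = ket a b (diagonal fun j => e j * (U j + V j)) := by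
    intro e
    rw [ket_diagonal, ket_diagonal,
      ← Equiv.sum_comp σ fun j => (e j * (U j + V j)) • prodKet (a j) (b j)]
    refine Finset.sum_congr rfl fun j _ => ?_
    ext p
    simp only [PiLp.smul_apply, prodKet_apply, smul_eq_mul, Function.comp_apply]
    have := hd0 j
    change e (σ j) * ‖d j‖ * (d j / ‖d j‖ * a (σ j) p.1 * b (σ j) p.2)
      = e (σ j) * d j * (a (σ j) p.1 * b (σ j) p.2)
    field_simp
  refine ⟨fun j => (d j / ‖d j‖) • a (σ j), b ∘ σ, fun j => ‖d j‖,
    orthonormal_phase_comp ha σ fun j => ?_, hb.comp _ σ.injective,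
    fun j => norm_pos_iff.mpr (hn (σ j)), ?_, ?_, ?_⟩
  · have := norm_ne_zero_iff.mpr (hn (σ j))
    rw [norm_div, norm_real, norm_norm]
    exact div_self this
  · rw [← h1]
    exact Equiv.sum_comp σ fun j => ‖U j + V j‖ ^ 2
  · have := key fun _ => 1
    simp only [one_mul] at this
    convert this using 3
    · ext j
      fin_cases j <;> rfl
    · rfl
  -- The sign is +1 on the support of `U` and -1 on that of `V`, which turns `U + V` into `U - V`.
  · have := key fun j => if j = σ 0 then 1 else -1
    have e1 : (diagonal fun j => (if σ j = σ 0 then (1 : ℂ) else -1) * ‖d j‖)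
        = diagonal ![(‖d 0‖ : ℂ), -‖d 1‖, -‖d 2‖] := by
      congr 1
      ext j
      fin_cases j <;> simp
    have e2 : (diagonal fun j => (if j = σ 0 then (1 : ℂ) else -1) * (U j + V j))
        = diagonal (U - V) := by
      congr 1
      ext j
      obtain ⟨k, rfl⟩ := σ.surjective j
      fin_cases k
      · simp [hV]
      · simp [hU1]
      · simp [hU2]
    rw [e1, e2] at this
    exact this

/-- A two-dimensional subhyperdisk of a Schmidt hyperdisk has the form
`r₀|00⟩ + e^{iα}(r₁|11⟩ + r₂|22⟩)` in suitable local bases. -/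
theorem exists_standard_form {S S₀ : Set (EuclideanSpace ℂ (ιA × ιB))}
    (hS : IsSchmidtHyperdisk 3 S) (hS₀ : IsSubhyperdisk 2 S₀ S) :
    ∃ (a : Fin 3 → EuclideanSpace ℂ ιA) (b : Fin 3 → EuclideanSpace ℂ ιB) (r : Fin 3 → ℝ),
      Orthonormal ℂ a ∧ Orthonormal ℂ b ∧ (∀ j, 0 < r j) ∧ ∑ j, r j ^ 2 = 1 ∧
      ket a b (diagonal ![(r 0 : ℂ), r 1, r 2]) ∈ S₀ ∧
      ket a b (diagonal ![(r 0 : ℂ), -r 1, -r 2]) ∈ Submodule.span ℂ S₀ := by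
  obtain ⟨a, b, ρ, ha, hb, hρ, hρ1, rfl⟩ := hS
  obtain ⟨hsub, hdisk⟩ := hS₀
  obtain ⟨u, v, hu, hv, huv⟩ := hdisk.exists_circle_subset
  have hform : ∀ e : ℂ, ‖e‖ = 1 → ∃ d : Fin 3 → ℂ, (∀ j, ‖d j‖ ^ 2 = ρ j ^ 2) ∧
      u + e • v = ket a b (diagonal d) := by
    intro e he
    obtain ⟨θ, hθ⟩ := hsub (huv e he)
    refine ⟨fun j => (ρ j : ℂ) * exp (θ j * I), fun j => ?_, ?_⟩
    · rw [norm_mul, norm_exp_ofReal_mul_I, mul_one, norm_real, Real.norm_eq_abs, sq_abs]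
    · rw [hθ, ket_diagonal]
  obtain ⟨d₁, n₁, e₁⟩ := hform 1 (by simp)
  obtain ⟨d₂, n₂, e₂⟩ := hform (-1) (by simp)
  obtain ⟨d₃, n₃, e₃⟩ := hform I (by simp)
  set U : Fin 3 → ℂ := (2⁻¹ : ℂ) • d₁ + (2⁻¹ : ℂ) • d₂ with hU
  set V : Fin 3 → ℂ := (2⁻¹ : ℂ) • d₁ + (-2⁻¹ : ℂ) • d₂ with hV
  have hu' : u = ket a b (diagonal U) := by
    rw [hU, ← smul_ket_diagonal_add, ← e₁, ← e₂]
    module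
  have hv' : v = ket a b (diagonal V) := by
    rw [hV, ← smul_ket_diagonal_add, ← e₁, ← e₂]
    module
  have hd₁ : ∀ j, U j + V j = d₁ j := fun j => by
    simp [hU, hV]; ring
  have hd₂ : ∀ j, U j - V j = d₂ j := fun j => by
    simp [hU, hV]; ring
  have hd₃ : ∀ j, U j + I * V j = d₃ j := fun j => by
    have h := smul_ket_diagonal_add a b 1 I U V
    rw [one_smul, ← hu', ← hv', e₃] at h
    have := congrFun (diagonal_injective (ket_injective ha hb h)) j
    simpa using this.symm
  -- Each Schmidt coefficient `U j + e V j` keeps its modulus for all phases `e`, so each Schmidt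
  -- term belongs to only one of the two groups.
  have hz : ∀ j, U j = 0 ∨ V j = 0 := fun j =>
    mul_eq_zero_of_norm_add_eq (by rw [hd₁, n₁]) (by rw [hd₂, n₂]) (by rw [hd₃, n₃])
  have hn : ∀ j, U j + V j ≠ 0 := fun j h => by
    have := n₁ j
    rw [← hd₁, h, norm_zero] at this
    exact hρ j (by simpa using this.symm)
  have h1 : ∑ j, ‖U j + V j‖ ^ 2 = 1 := by
    rw [← hρ1]
    exact Finset.sum_congr rfl fun j _ => by rw [hd₁, n₁]
  have hU0 : ¬ (U 0 = 0 ∧ U 1 = 0 ∧ U 2 = 0) := by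
    rintro ⟨h0, h1, h2⟩
    apply hu
    rw [hu', ket_diagonal, Fin.sum_univ_three, h0, h1, h2]
    simp
  have hV0 : ¬ (V 0 = 0 ∧ V 1 = 0 ∧ V 2 = 0) := by
    rintro ⟨h0, h1, h2⟩
    apply hv
    rw [hv', ket_diagonal, Fin.sum_univ_three, h0, h1, h2]
    simp
  have mem₁ : ket a b (diagonal (U + V)) ∈ S₀ := by
    have : U + V = d₁ := funext hd₁
    rw [this, ← e₁]
    exact huv 1 (by simp)
  have mem₂ : ket a b (diagonal (U - V)) ∈ Submodule.span ℂ S₀ := by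
    have : U - V = d₂ := funext hd₂
    rw [this, ← e₂]
    exact Submodule.subset_span (huv (-1) (by simp))
  -- Three terms in two nonempty groups: one group is a single term, which the permutation moves to
  -- index 0.
  have hσ : ∃ σ : Equiv.Perm (Fin 3), (V (σ 0) = 0 ∧ U (σ 1) = 0 ∧ U (σ 2) = 0) ∨
      (U (σ 0) = 0 ∧ V (σ 1) = 0 ∧ V (σ 2) = 0) := by
    have s01 : Equiv.swap (0 : Fin 3) 1 2 = 2 := by decide
    have s02 : Equiv.swap (0 : Fin 3) 2 1 = 1 := by decide
    rcases hz 0 with z0 | z0 <;> rcases hz 1 with z1 | z1 <;> rcases hz 2 with z2 | z2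
    · exact absurd ⟨z0, z1, z2⟩ hU0
    · exact ⟨Equiv.swap 0 2, Or.inl (by simp [s02, z0, z1, z2])⟩
    · exact ⟨Equiv.swap 0 1, Or.inl (by simp [s01, z0, z1, z2])⟩
    · exact ⟨1, Or.inr (by simp [z0, z1, z2])⟩
    · exact ⟨1, Or.inl (by simp [z0, z1, z2])⟩
    · exact ⟨Equiv.swap 0 1, Or.inr (by simp [s01, z0, z1, z2])⟩
    · exact ⟨Equiv.swap 0 2, Or.inr (by simp [s02, z0, z1, z2])⟩
    · exact absurd ⟨z0, z1, z2⟩ hV0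
  obtain ⟨σ, ⟨s0, s1, s2⟩ | ⟨s0, s1, s2⟩⟩ := hσ
  · obtain ⟨a', b', r, ha', hb', hr, hr1, k1, k2⟩ :=
      exists_adapted_bases ha hb U V hn h1 σ s0 s1 s2
    exact ⟨a', b', r, ha', hb', hr, hr1, k1 ▸ mem₁, k2 ▸ mem₂⟩
  · obtain ⟨a', b', r, ha', hb', hr, hr1, k1, k2⟩ :=
      exists_adapted_bases ha hb V U (fun j => by rw [add_comm]; exact hn j)
        (by simpa only [add_comm] using h1) σ s0 s1 s2
    refine ⟨a', b', r, ha', hb', hr, hr1, ?_, ?_⟩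
    · rw [k1, add_comm]
      exact mem₁
    · have : ket a b (diagonal (V - U)) = (-1 : ℂ) • ket a b (diagonal (U - V)) := by
        rw [← ket_smul, ← diagonal_smul]
        simp
      rw [k2, this]
      exact Submodule.smul_mem _ _ mem₂

/-! ### From the masking machine to the pencil. -/

theorem norm_ket_eq_one {a : Fin 3 → EuclideanSpace ℂ ιA} {b : Fin 3 → EuclideanSpace ℂ ιB}
    {r : Fin 3 → ℝ} (ha : Orthonormal ℂ a) (hb : Orthonormal ℂ b) (hr1 : ∑ j, r j ^ 2 = 1)
    {m : Matrix (Fin 3) (Fin 3) ℂ} (hm : HasMarginals r m) : ‖ket a b m‖ = 1 := by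
  have h := inner_ket ha hb m m
  rw [inner_self_eq_norm_sq_to_K, hm.2, trace_diagonal] at h
  have h1 : ∑ j, (r j : ℂ) ^ 2 = 1 := by exact_mod_cast hr1
  rw [h1] at h
  exact (pow_eq_one_iff_of_nonneg (norm_nonneg _) two_ne_zero).mp
    (ofReal_injective (by push_cast; exact h))

/-- The target states of a masking machine are the marginal-preserving states of a span of
`|00⟩`, `r₁|11⟩ + r₂|22⟩` and a further state. -/
theorem IsMaskingMachine.exists_eq_targetSet {HR : Type*} [NormedAddCommGroup HR]
    [InnerProductSpace ℂ HR] {V : HR →ₗᵢ[ℂ] EuclideanSpace ℂ (ιA × ιB)} {R : Set HR}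
    {ρA : Matrix ιA ιA ℂ} {ρB : Matrix ιB ιB ℂ} (hV : IsMaskingMachine V R ρA ρB)
    (hR : Submodule.span ℂ R = ⊤) (hn : Module.finrank ℂ HR = 3)
    {a : Fin 3 → EuclideanSpace ℂ ιA} {b : Fin 3 → EuclideanSpace ℂ ιB} {r : Fin 3 → ℝ}
    (ha : Orthonormal ℂ a) (hb : Orthonormal ℂ b) (hr : ∀ j, 0 < r j) (hr1 : ∑ j, r j ^ 2 = 1)
    (h₁ : ket a b (diagonal ![(r 0 : ℂ), r 1, r 2]) ∈ V '' R)
    (h₂ : ket a b (diagonal ![(r 0 : ℂ), -r 1, -r 2]) ∈ Submodule.span ℂ (V '' R)) :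
    ∃ X, HasMarginals r X ∧ (∀ x y, X ≠ pencil r X x y 0) ∧ V '' R = targetSet a b r X := by
  obtain ⟨hunit, hmarg, hmax⟩ := hV
  have hr0 : (r 0 : ℂ) ≠ 0 := ofReal_ne_zero.mpr (hr 0).ne'
  have hW : Submodule.span ℂ (V '' R) = LinearMap.range V.toLinearMap := by
    have := Submodule.map_span V.toLinearMap R
    rw [hR, Submodule.map_top] at this
    exact this.symm
  have hWfin : Module.finrank ℂ (LinearMap.range V.toLinearMap) = 3 := by
    rw [LinearMap.finrank_range_of_inj V.injective, hn]
  have hρ : HasMarginals r (diagonal ![(r 0 : ℂ), r 1, r 2]) := by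
    rw [hasMarginals_diagonal_iff r hr]
    intro j
    fin_cases j
    · simp [(hr 0).le]
    · simp [(hr 1).le]
    · simp [(hr 2).le]
  rw [hasMarginals_iff ha hb] at hρ
  have hρ' : traceB (ketBra (ket a b (diagonal ![(r 0 : ℂ), r 1, r 2]))) = ρA ∧
      traceA (ketBra (ket a b (diagonal ![(r 0 : ℂ), r 1, r 2]))) = ρB := by
    obtain ⟨ψ, hψ, h⟩ := h₁
    rw [← h]
    exact hmarg ψ hψ
  rw [hρ.1, hρ.2] at hρ'
  obtain ⟨hA, hB⟩ := hρ'
  set E := ket a b (diagonal ![1, 0, 0]) with hE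
  set D := ket a b (diagonal ![0, (r 1 : ℂ), (r 2 : ℂ)]) with hD
  have hpen : ∀ X x y z, ket a b (pencil r X x y z) = x • E + y • D + z • ket a b X := by
    intro X x y z
    simp only [pencil, ket_add, ket_smul, hE, hD]
  have hEmem : E ∈ Submodule.span ℂ (V '' R) := by
    have : E = (2 * r 0 : ℂ)⁻¹ • ket a b (diagonal ![(r 0 : ℂ), r 1, r 2])
        + (2 * r 0 : ℂ)⁻¹ • ket a b (diagonal ![(r 0 : ℂ), -r 1, -r 2]) := by
      rw [smul_ket_diagonal_add, hE]
      congr 2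
      ext j
      fin_cases j
      · simp; field_simp; norm_num
      · simp
      · simp
    rw [this]
    exact add_mem (Submodule.smul_mem _ _ (Submodule.subset_span h₁)) (Submodule.smul_mem _ _ h₂)
  have hDmem : D ∈ Submodule.span ℂ (V '' R) := by
    have : D = (2⁻¹ : ℂ) • ket a b (diagonal ![(r 0 : ℂ), r 1, r 2])
        + (-2⁻¹ : ℂ) • ket a b (diagonal ![(r 0 : ℂ), -r 1, -r 2]) := by
      rw [smul_ket_diagonal_add, hD]
      congr 2
      ext j
      fin_cases j
      · simp
      · simp; ring
      · simp; ring
    rw [this]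
    exact add_mem (Submodule.smul_mem _ _ (Submodule.subset_span h₁)) (Submodule.smul_mem _ _ h₂)
  have hED : LinearIndependent ℂ ![E, D] := by
    rw [LinearIndependent.pair_iff]
    intro x y h
    rw [hE, hD, smul_ket_diagonal_add] at h
    have h0 : ket a b 0 = 0 := by simp [ket]
    have h' := diagonal_eq_zero.mp (ket_injective ha hb (h.trans h0.symm))
    have k0 := congrFun h' 0
    have k1 := congrFun h' 1
    simp at k0 k1
    exact ⟨k0, k1.resolve_right (hr 1).ne'⟩
  -- The target states span a space of dimension 3, so they cannot all lie in the plane of `E` and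
  -- `D`.
  obtain ⟨Φ, hΦ, hΦn⟩ : ∃ Φ ∈ V '' R, Φ ∉ Submodule.span ℂ (Set.range ![E, D]) := by
    by_contra hcon
    push Not at hcon
    have hle : Submodule.span ℂ (V '' R) ≤ Submodule.span ℂ (Set.range ![E, D]) :=
      Submodule.span_le.mpr hcon
    have := Submodule.finrank_mono hle
    rw [hW, hWfin, finrank_span_eq_card hED] at this
    simp at this
  obtain ⟨X, rfl⟩ : ∃ X, Φ = ket a b X := by
    obtain ⟨ψ, hψ, rfl⟩ := hΦ
    refine exists_eq_ket ha hb (diagonal fun j => (r j : ℂ) ^ 2) ?_ ?_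
    · rw [(hmarg ψ hψ).1, hA]
    · rw [(hmarg ψ hψ).2, hB]
  have hmargT : ∀ {m}, ket a b m ∈ V '' R → HasMarginals r m := by
    rintro m ⟨ψ, hψ, h⟩
    rw [hasMarginals_iff ha hb, ← h, hA, hB]
    exact hmarg ψ hψ
  have hli : LinearIndependent ℂ ![ket a b X, E, D] :=
    linearIndependent_finCons.mpr ⟨hED, hΦn⟩
  have hspan : Submodule.span ℂ (Set.range ![ket a b X, E, D])
      = LinearMap.range V.toLinearMap := by
    refine Submodule.eq_of_le_of_finrank_eq ?_ ?_
    · rw [Submodule.span_le, ← hW]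
      rintro _ ⟨j, rfl⟩
      fin_cases j
      · exact Submodule.subset_span hΦ
      · exact hEmem
      · exact hDmem
    · rw [finrank_span_eq_card hli, hWfin]
      simp
  refine ⟨X, hmargT hΦ, ?_, ?_⟩
  · intro x y h
    apply hΦn
    rw [h, hpen, zero_smul, add_zero]
    exact add_mem (Submodule.smul_mem _ _ (Submodule.subset_span ⟨0, rfl⟩))
      (Submodule.smul_mem _ _ (Submodule.subset_span ⟨1, rfl⟩))
  · ext Ψ
    constructor
    · intro hΨ
      have hmem : Ψ ∈ Submodule.span ℂ (Set.range ![ket a b X, E, D]) := by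
        rw [hspan, ← hW]
        exact Submodule.subset_span hΨ
      rw [Submodule.mem_span_range_iff_exists_fun] at hmem
      obtain ⟨c, hc⟩ := hmem
      have : Ψ = ket a b (pencil r X (c 1) (c 2) (c 0)) := by
        rw [hpen, ← hc, Fin.sum_univ_three]
        simp only [cons_val_zero, cons_val_one, cons_val]
        abel
      rw [this] at hΨ ⊢
      exact ⟨_, _, _, hmargT hΨ, rfl⟩
    · rintro ⟨x, y, z, h, rfl⟩
      have hmem : ket a b (pencil r X x y z) ∈ LinearMap.range V.toLinearMap := by
        rw [hpen, ← hspan]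
        exact add_mem (add_mem (Submodule.smul_mem _ _ (Submodule.subset_span ⟨1, rfl⟩))
          (Submodule.smul_mem _ _ (Submodule.subset_span ⟨2, rfl⟩)))
          (Submodule.smul_mem _ _ (Submodule.subset_span ⟨0, rfl⟩))
      obtain ⟨ψ, hψ⟩ := hmem
      have hψ' : V ψ = ket a b (pencil r X x y z) := hψ
      refine ⟨ψ, ?_, hψ'⟩
      -- A masking machine's set contains every unit vector with the right marginals, so `ψ` cannot
      -- be left out of `R`.
      by_contra hψR
      have hnorm : ‖ψ‖ = 1 := by
        rw [← V.norm_map, hψ', norm_ket_eq_one ha hb hr1 h]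
      have hm := (hasMarginals_iff ha hb r _).mp h
      rw [hA, hB, ← hψ'] at hm
      rcases hmax ψ hnorm hψR with h' | h'
      · exact h' hm.1
      · exact h' hm.2

end Masking

end

theorem theorem2 {ιA ιB : Type*} [Fintype ιA] [Fintype ιB]
    {HR : Type*} [NormedAddCommGroup HR] [InnerProductSpace ℂ HR]
    (V : HR →ₗᵢ[ℂ] EuclideanSpace ℂ (ιA × ιB)) (R : Set HR)
    (ρA : Matrix ιA ιA ℂ) (ρB : Matrix ιB ιB ℂ)
    (hV : Masking.IsMaskingMachine V R ρA ρB)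
    (hR : Submodule.span ℂ R = ⊤)
    (hn : Module.finrank ℂ HR = 3)
    (hdA : ρA.rank = 3) (hdB : ρB.rank = 3)
    (hT : ∃ S S₀ : Set (EuclideanSpace ℂ (ιA × ιB)),
      Masking.IsSchmidtHyperdisk 3 S ∧ Masking.IsSubhyperdisk 2 S₀ S ∧ S₀ ⊆ V '' R) :
    Masking.IsTypeI (V '' R) ∨ Masking.IsTypeII (V '' R) ∨ Masking.IsTypeIII (V '' R) := by
  obtain ⟨S, S₀, hS, hS₀, hsub⟩ := hT
  obtain ⟨a, b, r, ha, hb, hr, hr1, h₁, h₂⟩ := Masking.exists_standard_form hS hS₀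
  obtain ⟨X, hX, hni, hVR⟩ := hV.exists_eq_targetSet hR hn ha hb hr hr1 (hsub h₁)
    (Submodule.span_mono hsub h₂)
  rw [hVR]
  exact Masking.targetSet_classification ha hb hr hr1 hX hni
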